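/- **Conventions.** Let $\mathcal T$, $M$ be smooth manifolds of dimensions $m$, $n$. Let $(t^a)$, $(x^i)$ be local coordinates on them with coordinate domains identified with open sets $U\subseteq\mathbb R^m$, $V\subseteq\mathbb R^n$, and let $(t^a,x^i,p_i^a)$ be the induced coordinates on the part $U\times V\times\mathbb R^{mn}$ of the dual 1-jet space $E^*=J^{1*}(\mathcal T,M)$ over $U\times V$. Indices $a,b,c,d,f,\dots$ run from $1$ to $m$ and $i,j,k,l,r,\dots$ from $1$ to $n$; repeated indices are summed. Everything is smooth. Let $N=(\underset1N{}^{(a)}_{(i)b},\underset2N{}^{(a)}_{(i)j})$ be a nonlinear connection, with adapted bases $$\frac{\delta}{\delta t^a}=\frac{\partial}{\partial t^a}-\underset1N{}^{(b)}_{(j)a}\frac{\partial}{\partial p^b_j},\quad \frac{\delta}{\delta x^i}=\frac{\partial}{\partial x^i}-\underset2N{}^{(b)}_{(j)i}\frac{\partial}{\partial p^b_j},\quad \frac{\partial}{\partial p_i^a};\qquad dt^a,\ dx^i,\ \delta p^a_i=dp^a_i+\underset1N{}^{(a)}_{(i)b}dt^b+\underset2N{}^{(a)}_{(i)j}dx^j,$$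 and let $h_T,h_M,v$ be the associated projections of $TE^*$ onto the three distributions spanned. Let $h_{ab}(t)$ be a semi-Riemannian metric on $\mathcal T$ with Christoffel symbols $\chi^a_{bc}$ and curvature $$\chi^d_{abc}=\frac{\partial\chi^d_{ab}}{\partial t^c}-\frac{\partial\chi^d_{ac}}{\partial t^b}+\chi^f_{ab}\chi^d_{fc}-\chi^f_{ac}\chi^d_{fb}.$$ Let $D$ be a linear connection on $E^*$ with $Dh_T=0$, $Dh_M=0$, $Dv=0$. Its nine adapted components are given by $D_{\delta/\delta t^c}\frac{\delta}{\delta t^b}=A^a_{bc}\frac{\delta}{\delta t^a}$, $D_{\delta/\delta t^c}\frac{\delta}{\delta x^j}=A^i_{jc}\frac{\delta}{\delta x^i}$, $D_{\delta/\delta t^c}\frac{\partial}{\partial p^b_j}=-A^{(a)(j)}_{(i)(b)c}\frac{\partial}{\partial p^a_i}$, and in the same way $H^a_{bk},H^i_{jk},-H^{(a)(j)}_{(i)(b)k}$ for $D_{\delta/\delta x^k}$ and $C^{a(k)}_{b(c)},C^{i(k)}_{j(c)},-C^{(a)(j)(k)}_{(i)(b)(c)}$ for $D_{\partial/\partial p^c_k}$.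 Assume that $D$ is $h$-normal, that is, $$A^a_{bc}=\chi^a_{bc},\quad H^a_{bi}=0,\quad C^{a(i)}_{b(c)}=0,\quad D\mathbb J=0\ \text{ for }\ \mathbb J=h_{ab}\,\delta^i_j\,\delta p^a_i\otimes dt^b\otimes dx^j,$$ and of Cartan type, that is, $H^i_{jk}=H^i_{kj}$ and $C^{i(k)}_{j(c)}=C^{k(i)}_{j(c)}$. Let $X=X^a\frac{\delta}{\delta t^a}+X^i\frac{\delta}{\delta x^i}+X^{(a)}_{(i)}\frac{\partial}{\partial p^a_i}$ be any vector field. The symbols ${}_{/c}$, ${}_{|k}$, $|^{(k)}_{(c)}$ denote the components in the adapted bases of the covariant derivatives of d-tensors in the directions $\delta/\delta t^c$, $\delta/\delta x^k$, $\partial/\partial p^c_k$. A second covariant derivative, such as $X^a_{/b|k}$ or $X^a|^{(k)}_{(c)/b}$, is the covariant derivative of the d-tensor formed by the first one, so it includes the terms for the index of the first derivative. **Torsion d-tensors.** $$T^r_{aj}=-A^r_{ja},\quad P^{(f)\,(j)}_{(r)a(b)}=\frac{\partial\underset1N{}^{(f)}_{(r)a}}{\partial p^b_j}+\delta^f_bA^j_{ra}-\delta^j_r\chi^f_{ba},\quad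 P^{(f)\,(j)}_{(r)i(b)}=\frac{\partial\underset2N{}^{(f)}_{(r)i}}{\partial p^b_j}+\delta^f_bH^j_{ri},$$ $$R^{(f)}_{(r)ab}=\frac{\delta\underset1N{}^{(f)}_{(r)a}}{\delta t^b}-\frac{\delta\underset1N{}^{(f)}_{(r)b}}{\delta t^a},\quad R^{(f)}_{(r)aj}=\frac{\delta\underset1N{}^{(f)}_{(r)a}}{\delta x^j}-\frac{\delta\underset2N{}^{(f)}_{(r)j}}{\delta t^a},\quad R^{(f)}_{(r)ij}=\frac{\delta\underset2N{}^{(f)}_{(r)i}}{\delta x^j}-\frac{\delta\underset2N{}^{(f)}_{(r)j}}{\delta x^i},$$ $$S^{(f)(i)(j)}_{(r)(a)(b)}=-\big(\delta^f_aC^{i(j)}_{r(b)}-\delta^f_bC^{j(i)}_{r(a)}\big).$$ **Curvature d-tensors.** $$R^l_{ibc}=\frac{\delta A^l_{ib}}{\delta t^c}-\frac{\delta A^l_{ic}}{\delta t^b}+A^r_{ib}A^l_{rc}-A^r_{ic}A^l_{rb}+C^{l(r)}_{i(f)}R^{(f)}_{(r)bc},$$ $$R^l_{ibk}=\frac{\delta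 A^l_{ib}}{\delta x^k}-\frac{\delta H^l_{ik}}{\delta t^b}+A^r_{ib}H^l_{rk}-H^r_{ik}A^l_{rb}+C^{l(r)}_{i(f)}R^{(f)}_{(r)bk},$$ $$R^l_{ijk}=\frac{\delta H^l_{ij}}{\delta x^k}-\frac{\delta H^l_{ik}}{\delta x^j}+H^r_{ij}H^l_{rk}-H^r_{ik}H^l_{rj}+C^{l(r)}_{i(f)}R^{(f)}_{(r)jk},$$ $$P^{l\,(k)}_{ib(c)}=\frac{\partial A^l_{ib}}{\partial p^c_k}-C^{l(k)}_{i(c)/b}+C^{l(r)}_{i(f)}P^{(f)\,(k)}_{(r)b(c)},\qquad P^{l\,(k)}_{ij(c)}=\frac{\partial H^l_{ij}}{\partial p^c_k}-C^{l(k)}_{i(c)|j}+C^{l(r)}_{i(f)}P^{(f)\,(k)}_{(r)j(c)},$$ $$S^{l(j)(k)}_{i(b)(c)}=\frac{\partial C^{l(j)}_{i(b)}}{\partial p^c_k}-\frac{\partial C^{l(k)}_{i(c)}}{\partial p^b_j}+C^{r(j)}_{i(b)}C^{l(k)}_{r(c)}-C^{r(k)}_{i(c)}C^{l(j)}_{r(b)}.$$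 **Theorem (local Ricci identities).** At every point of the coordinate domain and for all values of the free indices the following eighteen identities hold. *The $h_{\mathcal T}$-Ricci identities:* - $X^a_{/b/c}-X^a_{/c/b}=X^f\chi^a_{fbc}-X^a|^{(r)}_{(f)}R^{(f)}_{(r)bc}$ - $X^a_{/b|k}-X^a_{|k/b}=-X^a_{|r}T^r_{bk}-X^a|^{(r)}_{(f)}R^{(f)}_{(r)bk}$ - $X^a_{|j|k}-X^a_{|k|j}=-X^a|^{(r)}_{(f)}R^{(f)}_{(r)jk}$ - $X^a_{/b}|^{(k)}_{(c)}-X^a|^{(k)}_{(c)/b}=-X^a|^{(r)}_{(f)}P^{(f)\,(k)}_{(r)b(c)}$ - $X^a_{|j}|^{(k)}_{(c)}-X^a|^{(k)}_{(c)|j}=-X^a_{|r}C^{r(k)}_{j(c)}-X^a|^{(r)}_{(f)}P^{(f)\,(k)}_{(r)j(c)}$ - $X^a|^{(j)}_{(b)}|^{(k)}_{(c)}-X^a|^{(k)}_{(c)}|^{(j)}_{(b)}=-X^a|^{(r)}_{(f)}S^{(f)(j)(k)}_{(r)(b)(c)}$ *The $h_M$-Ricci identities:* - $X^i_{/b/c}-X^i_{/c/b}=X^rR^i_{rbc}-X^i|^{(r)}_{(f)}R^{(f)}_{(r)bc}$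 - $X^i_{/b|k}-X^i_{|k/b}=X^rR^i_{rbk}-X^i_{|r}T^r_{bk}-X^i|^{(r)}_{(f)}R^{(f)}_{(r)bk}$ - $X^i_{|j|k}-X^i_{|k|j}=X^rR^i_{rjk}-X^i|^{(r)}_{(f)}R^{(f)}_{(r)jk}$ - $X^i_{/b}|^{(k)}_{(c)}-X^i|^{(k)}_{(c)/b}=X^rP^{i\,(k)}_{rb(c)}-X^i|^{(r)}_{(f)}P^{(f)\,(k)}_{(r)b(c)}$ - $X^i_{|j}|^{(k)}_{(c)}-X^i|^{(k)}_{(c)|j}=X^rP^{i\,(k)}_{rj(c)}-X^i_{|r}C^{r(k)}_{j(c)}-X^i|^{(r)}_{(f)}P^{(f)\,(k)}_{(r)j(c)}$ - $X^i|^{(j)}_{(b)}|^{(k)}_{(c)}-X^i|^{(k)}_{(c)}|^{(j)}_{(b)}=X^rS^{i(j)(k)}_{r(b)(c)}-X^i|^{(r)}_{(f)}S^{(f)(j)(k)}_{(r)(b)(c)}$ *The $v$-Ricci identities:* - $X^{(a)}_{(i)/b/c}-X^{(a)}_{(i)/c/b}=-X^{(a)}_{(r)}R^r_{ibc}+X^{(f)}_{(i)}\chi^a_{fbc}-X^{(a)}_{(i)}|^{(r)}_{(f)}R^{(f)}_{(r)bc}$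 - $X^{(a)}_{(i)/b|k}-X^{(a)}_{(i)|k/b}=-X^{(a)}_{(r)}R^r_{ibk}-X^{(a)}_{(i)|r}T^r_{bk}-X^{(a)}_{(i)}|^{(r)}_{(f)}R^{(f)}_{(r)bk}$ - $X^{(a)}_{(i)|j|k}-X^{(a)}_{(i)|k|j}=-X^{(a)}_{(r)}R^r_{ijk}-X^{(a)}_{(i)}|^{(r)}_{(f)}R^{(f)}_{(r)jk}$ - $X^{(a)}_{(i)/b}|^{(k)}_{(c)}-X^{(a)}_{(i)}|^{(k)}_{(c)/b}=-X^{(a)}_{(r)}P^{r\,(k)}_{ib(c)}-X^{(a)}_{(i)}|^{(r)}_{(f)}P^{(f)\,(k)}_{(r)b(c)}$ - $X^{(a)}_{(i)|j}|^{(k)}_{(c)}-X^{(a)}_{(i)}|^{(k)}_{(c)|j}=-X^{(a)}_{(r)}P^{r\,(k)}_{ij(c)}-X^{(a)}_{(i)|r}C^{r(k)}_{j(c)}-X^{(a)}_{(i)}|^{(r)}_{(f)}P^{(f)\,(k)}_{(r)j(c)}$ - $X^{(a)}_{(i)}|^{(j)}_{(b)}|^{(k)}_{(c)}-X^{(a)}_{(i)}|^{(k)}_{(c)}|^{(j)}_{(b)}=-X^{(a)}_{(r)}S^{r(j)(k)}_{i(b)(c)}-X^{(a)}_{(i)}|^{(r)}_{(f)}S^{(f)(j)(k)}_{(r)(b)(c)}$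 -/

import Mathlib

open scoped Manifold ContDiff

noncomputable section

namespace DualJet

/-- The coordinate space of the dual 1-jet bundle `J^{1*}(T, M)`, `dim T = m`, `dim M = n`.
A point is `(t, x, p)` with `t a = t^a`, `x i = x^i` and `p i a = p_i^a`. -/
abbrev JetCoord (m n : ℕ) : Type :=
  (Fin m → ℝ) × (Fin n → ℝ) × (Fin n → Fin m → ℝ)

/-- The part of the dual 1-jet bundle over coordinate domains `U` of `T` and `V` of `M`,
written in the induced coordinates: `U × V × ℝ^{mn}`. -/
def jetDomain {m n : ℕ} (U : Set (Fin m → ℝ)) (V : Set (Fin n → ℝ)) : Set (JetCoord m n) :=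
  {e | e.1 ∈ U ∧ e.2.1 ∈ V}

/-- Vector fields on the coordinate space; all tangent spaces are identified with `JetCoord m n`
through the coordinate vector fields `∂/∂t^a`, `∂/∂x^i`, `∂/∂p_i^a`. -/
abbrev JetField (m n : ℕ) : Type := JetCoord m n → JetCoord m n

/-- The vector field is smooth on the set `W`. -/
def IsSmoothField {m n : ℕ} (W : Set (JetCoord m n)) (X : JetField m n) : Prop :=
  ContDiffOn ℝ ∞ X W

/-- Type of operators `D`; `D Y e v` is the value at `e` of the derivative of the vector field `Y`
in the direction of the tangent vector `v`, so that `D Y e (X e) = (D_X Y)(e)`. -/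
abbrev JetConnection (m n : ℕ) : Type :=
  JetField m n → JetCoord m n → JetCoord m n →L[ℝ] JetCoord m n

/-- A nonlinear connection in the induced coordinates:
`N1 a i b = N₁^{(a)}_{(i)b}` (temporal) and `N2 a i j = N₂^{(a)}_{(i)j}` (spatial components). -/
structure NonlinearConnection {m n : ℕ} (U : Set (Fin m → ℝ)) (V : Set (Fin n → ℝ)) where
  N1 : Fin m → Fin n → Fin m → JetCoord m n → ℝ
  N2 : Fin m → Fin n → Fin n → JetCoord m n → ℝ
  smooth1 : ∀ a i b, ContDiffOn ℝ ∞ (N1 a i b) (jetDomain U V)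
  smooth2 : ∀ a i j, ContDiffOn ℝ ∞ (N2 a i j) (jetDomain U V)

/-- A semi-Riemannian metric `h_{ab}(t)` on the coordinate domain `U`. -/
structure TemporalMetric {m : ℕ} (U : Set (Fin m → ℝ)) where
  g : (Fin m → ℝ) → Matrix (Fin m) (Fin m) ℝ
  smooth : ∀ a b, ContDiffOn ℝ ∞ (fun t => g t a b) U
  symm : ∀ t ∈ U, (g t).IsSymm
  nondeg : ∀ t ∈ U, (g t).det ≠ 0

section Metric

variable {m : ℕ} {U : Set (Fin m → ℝ)}

/-- `∂f/∂t^c` for a function `f` of `t`. -/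
def dT (c : Fin m) (f : (Fin m → ℝ) → ℝ) (t : Fin m → ℝ) : ℝ :=
  fderiv ℝ f t (Pi.single c 1)

/-- The Christoffel symbols `χ^a_{bc}(t)` of the metric. -/
def christoffel (h : TemporalMetric U) (a b c : Fin m) (t : Fin m → ℝ) : ℝ :=
  (1 / 2) * ∑ d, (h.g t)⁻¹ a d *
    (dT b (fun s => h.g s d c) t + dT c (fun s => h.g s d b) t - dT d (fun s => h.g s b c) t)

/-- The curvature `χ^d_{abc}(t)` of the metric. -/
def chiCurv (h : TemporalMetric U) (d a b c : Fin m) (t : Fin m → ℝ) : ℝ :=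
  dT c (christoffel h d a b) t - dT b (christoffel h d a c) t
    + ∑ f, christoffel h f a b t * christoffel h d f c t
    - ∑ f, christoffel h f a c t * christoffel h d f b t

end Metric

/-- The index set `{a, i, (a)(i)}` of the adapted bases. -/
abbrev AIdx (m n : ℕ) : Type := Fin m ⊕ Fin n ⊕ (Fin m × Fin n)

/-- The temporal index `a`. -/
abbrev tI {m n : ℕ} (a : Fin m) : AIdx m n := Sum.inl a

/-- The spatial index `i`. -/
abbrev xI {m n : ℕ} (i : Fin n) : AIdx m n := Sum.inr (Sum.inl i)

/-- The double index `(a)(i)` of the polymomentum `p_i^a`. -/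
abbrev pI {m n : ℕ} (a : Fin m) (i : Fin n) : AIdx m n := Sum.inr (Sum.inr (a, i))

section Adapted

variable {m n : ℕ} {U : Set (Fin m → ℝ)} {V : Set (Fin n → ℝ)}

/-- `∂/∂p_i^a`. -/
def ddP (a : Fin m) (i : Fin n) : JetField m n :=
  fun _ => (0, 0, Pi.single i (Pi.single a 1))

/-- `δ/δt^a = ∂/∂t^a - N₁^{(b)}_{(j)a} ∂/∂p_j^b`. -/
def deltaT (N : NonlinearConnection U V) (a : Fin m) : JetField m n :=
  fun e => (Pi.single a 1, 0, fun j b => -N.N1 b j a e)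

/-- `δ/δx^i = ∂/∂x^i - N₂^{(b)}_{(j)i} ∂/∂p_j^b`. -/
def deltaX (N : NonlinearConnection U V) (i : Fin n) : JetField m n :=
  fun e => (0, Pi.single i 1, fun j b => -N.N2 b j i e)

/-- The adapted basis `{δ/δt^a, δ/δx^i, ∂/∂p_i^a}` of vector fields. -/
def frame (N : NonlinearConnection U V) : AIdx m n → JetField m n
  | Sum.inl a => deltaT N a
  | Sum.inr (Sum.inl i) => deltaX N i
  | Sum.inr (Sum.inr (a, i)) => ddP a i

/-- The adapted basis `{dt^a, dx^i, δp_i^a}` of covector fields, with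
`δp_i^a = dp_i^a + N₁^{(a)}_{(i)b} dt^b + N₂^{(a)}_{(i)j} dx^j`. -/
def coframe (N : NonlinearConnection U V) : AIdx m n → JetCoord m n → JetCoord m n → ℝ
  | Sum.inl a, _, v => v.1 a
  | Sum.inr (Sum.inl i), _, v => v.2.1 i
  | Sum.inr (Sum.inr (a, i)), e, v =>
      v.2.2 i a + ∑ b, N.N1 a i b e * v.1 b + ∑ j, N.N2 a i j e * v.2.1 j

/-- The canonical projection `h_T`. -/
def projT (N : NonlinearConnection U V) (e v : JetCoord m n) : JetCoord m n :=
  ∑ a, coframe N (tI a) e v • deltaT N a e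

/-- The canonical projection `h_M`. -/
def projM (N : NonlinearConnection U V) (e v : JetCoord m n) : JetCoord m n :=
  ∑ i, coframe N (xI i) e v • deltaX N i e

/-- The canonical projection `v` on the vertical distribution. -/
def projV (N : NonlinearConnection U V) (e v : JetCoord m n) : JetCoord m n :=
  ∑ a, ∑ i, coframe N (pI a i) e v • ddP a i e

/-- `D` is an `N`-linear connection: a smooth linear connection on `jetDomain U V` with
`D h_T = 0`, `D h_M = 0` and `D v = 0`. -/
structure IsNLinear (N : NonlinearConnection U V) (D : JetConnection m n) : Prop where
  isCov : IsCovariantDerivativeOn (I := 𝓘(ℝ, JetCoord m n)) (JetCoord m n)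
    (V := fun e : JetCoord m n => TangentSpace 𝓘(ℝ, JetCoord m n) e) D (jetDomain U V)
  smooth : ContMDiffCovariantDerivativeOn (I := 𝓘(ℝ, JetCoord m n)) (JetCoord m n)
    (V := fun e : JetCoord m n => TangentSpace 𝓘(ℝ, JetCoord m n) e) ∞ D (jetDomain U V)
  projT_parallel : ∀ Y : JetField m n, IsSmoothField (jetDomain U V) Y →
    ∀ e ∈ jetDomain U V, ∀ v : JetCoord m n,
      D (fun e' => projT N e' (Y e')) e v = projT N e (D Y e v)
  projM_parallel : ∀ Y : JetField m n, IsSmoothField (jetDomain U V) Y →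
    ∀ e ∈ jetDomain U V, ∀ v : JetCoord m n,
      D (fun e' => projM N e' (Y e')) e v = projM N e (D Y e v)
  projV_parallel : ∀ Y : JetField m n, IsSmoothField (jetDomain U V) Y →
    ∀ e ∈ jetDomain U V, ∀ v : JetCoord m n,
      D (fun e' => projV N e' (Y e')) e v = projV N e (D Y e v)

/-- The coefficients `Γ^F_{BC}` of `D` in the adapted basis: `D_{Y_C} Y_B = Γ^F_{BC} Y_F`. -/
def Gam (N : NonlinearConnection U V) (D : JetConnection m n) (F B C : AIdx m n)
    (e : JetCoord m n) : ℝ :=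
  coframe N F e (D (frame N B) e (frame N C e))

variable (N : NonlinearConnection U V) (D : JetConnection m n)

/-! The nine adapted components of `D`. The suffix `t`, `x`, `p` tells on which of the three
distributions the coefficient acts. -/

/-- `At a b c = A^a_{bc}`. -/
def At (a b c : Fin m) : JetCoord m n → ℝ := Gam N D (tI a) (tI b) (tI c)

/-- `Ax i j c = A^i_{jc}`. -/
def Ax (i j : Fin n) (c : Fin m) : JetCoord m n → ℝ := Gam N D (xI i) (xI j) (tI c)

/-- `Ap a i b j c = A^{(a)(j)}_{(i)(b)c}`, where
`D_{δ/δt^c} ∂/∂p_j^b = -A^{(a)(j)}_{(i)(b)c} ∂/∂p_i^a`. -/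
def Ap (a : Fin m) (i : Fin n) (b : Fin m) (j : Fin n) (c : Fin m) : JetCoord m n → ℝ :=
  fun e => -Gam N D (pI a i) (pI b j) (tI c) e

/-- `Ht a b k = H^a_{bk}`. -/
def Ht (a b : Fin m) (k : Fin n) : JetCoord m n → ℝ := Gam N D (tI a) (tI b) (xI k)

/-- `Hx i j k = H^i_{jk}`. -/
def Hx (i j k : Fin n) : JetCoord m n → ℝ := Gam N D (xI i) (xI j) (xI k)

/-- `Hp a i b j k = H^{(a)(j)}_{(i)(b)k}`, where
`D_{δ/δx^k} ∂/∂p_j^b = -H^{(a)(j)}_{(i)(b)k} ∂/∂p_i^a`. -/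
def Hp (a : Fin m) (i : Fin n) (b : Fin m) (j : Fin n) (k : Fin n) : JetCoord m n → ℝ :=
  fun e => -Gam N D (pI a i) (pI b j) (xI k) e

/-- `Ct a b c k = C^{a(k)}_{b(c)}`. -/
def Ct (a b c : Fin m) (k : Fin n) : JetCoord m n → ℝ := Gam N D (tI a) (tI b) (pI c k)

/-- `Cx i j c k = C^{i(k)}_{j(c)}`. -/
def Cx (i j : Fin n) (c : Fin m) (k : Fin n) : JetCoord m n → ℝ := Gam N D (xI i) (xI j) (pI c k)

/-- `Cp a i b j c k = C^{(a)(j)(k)}_{(i)(b)(c)}`, where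
`D_{∂/∂p_k^c} ∂/∂p_j^b = -C^{(a)(j)(k)}_{(i)(b)(c)} ∂/∂p_i^a`. -/
def Cp (a : Fin m) (i : Fin n) (b : Fin m) (j : Fin n) (c : Fin m) (k : Fin n) :
    JetCoord m n → ℝ :=
  fun e => -Gam N D (pI a i) (pI b j) (pI c k) e

/-- The `h`-normalization tensor `J = h_{ab} δ^i_j δp_i^a ⊗ dt^b ⊗ dx^j`. -/
def hNormalization (h : TemporalMetric U) (e v u w : JetCoord m n) : ℝ :=
  ∑ a, ∑ b, ∑ i, h.g e.1 a b * coframe N (pI a i) e v * coframe N (tI b) e u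
    * coframe N (xI i) e w

/-- `D` is an `h`-normal `N`-linear connection: `A^a_{bc} = χ^a_{bc}`, `H^a_{bi} = 0`,
`C^{a(i)}_{b(c)} = 0` and `D J = 0`. -/
structure IsHNormal (h : TemporalMetric U) : Prop where
  nlinear : IsNLinear N D
  At_eq : ∀ a b c, ∀ e ∈ jetDomain U V, At N D a b c e = christoffel h a b c e.1
  Ht_eq : ∀ a b k, ∀ e ∈ jetDomain U V, Ht N D a b k e = 0
  Ct_eq : ∀ a b c k, ∀ e ∈ jetDomain U V, Ct N D a b c k e = 0
  J_parallel : ∀ Y Z S : JetField m n, IsSmoothField (jetDomain U V) Y →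
    IsSmoothField (jetDomain U V) Z → IsSmoothField (jetDomain U V) S →
    ∀ e ∈ jetDomain U V, ∀ v : JetCoord m n,
      fderiv ℝ (fun e' => hNormalization N h e' (Y e') (Z e') (S e')) e v
        - hNormalization N h e (D Y e v) (Z e) (S e)
        - hNormalization N h e (Y e) (D Z e v) (S e)
        - hNormalization N h e (Y e) (Z e) (D S e v) = 0

/-- `D` is an `h`-normal `N`-linear connection of Cartan type: moreover
`H^i_{jk} = H^i_{kj}` and `C^{i(k)}_{j(c)} = C^{k(i)}_{j(c)}`. -/
structure IsCartan (h : TemporalMetric U) : Prop extends IsHNormal N D h where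
  Hx_symm : ∀ i j k, ∀ e ∈ jetDomain U V, Hx N D i j k e = Hx N D i k j e
  Cx_symm : ∀ i j c k, ∀ e ∈ jetDomain U V, Cx N D i j c k e = Cx N D k j c i e

/-- Derivative of a function along the adapted basis vector field `Y_C`, that is
`δf/δt^c`, `δf/δx^k` or `∂f/∂p_k^c`. -/
def der (C : AIdx m n) (f : JetCoord m n → ℝ) (e : JetCoord m n) : ℝ :=
  fderiv ℝ f e (frame N C e)

/-- The adapted components `X^a`, `X^i`, `X^{(a)}_{(i)}` of a d-vector field. -/
def comp (X : JetField m n) (A : AIdx m n) (e : JetCoord m n) : ℝ := coframe N A e (X e)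

/-- First covariant derivatives of a d-vector field; `cov1 N D X A C` is
`X^A_{/c}` for `C = tI c`, `X^A_{|k}` for `C = xI k`, and `X^A|^{(k)}_{(c)}` for `C = pI c k`. -/
def cov1 (X : JetField m n) (A C : AIdx m n) (e : JetCoord m n) : ℝ :=
  der N C (comp N X A) e + ∑ F, comp N X F e * Gam N D A F C e

/-- Second covariant derivatives of a d-vector field: the covariant derivative, in the direction of
`C`, of the d-tensor with components `cov1 N D X A B`; so `cov2 N D X A B C` is
`X^A_{/b/c}` for `B = tI b, C = tI c`, it is `X^A_{/b|k}` for `B = tI b, C = xI k`, etc. -/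
def cov2 (X : JetField m n) (A B C : AIdx m n) (e : JetCoord m n) : ℝ :=
  der N C (cov1 N D X A B) e + ∑ F, cov1 N D X F B e * Gam N D A F C e
    - ∑ F, cov1 N D X A F e * Gam N D F B C e

/-! The torsion d-tensors. -/

/-- `torT r a j = T^r_{aj} = -A^r_{ja}`. -/
def torT (r : Fin n) (a : Fin m) (j : Fin n) (e : JetCoord m n) : ℝ := -Ax N D r j a e

/-- `torRtt f r a b = R^{(f)}_{(r)ab}`. -/
def torRtt (f : Fin m) (r : Fin n) (a b : Fin m) (e : JetCoord m n) : ℝ :=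
  der N (tI b) (N.N1 f r a) e - der N (tI a) (N.N1 f r b) e

/-- `torRtx f r a j = R^{(f)}_{(r)aj}`. -/
def torRtx (f : Fin m) (r : Fin n) (a : Fin m) (j : Fin n) (e : JetCoord m n) : ℝ :=
  der N (xI j) (N.N1 f r a) e - der N (tI a) (N.N2 f r j) e

/-- `torRxx f r i j = R^{(f)}_{(r)ij}`. -/
def torRxx (f : Fin m) (r i j : Fin n) (e : JetCoord m n) : ℝ :=
  der N (xI j) (N.N2 f r i) e - der N (xI i) (N.N2 f r j) e

/-- `torPt h f r a b j = P^{(f) (j)}_{(r)a(b)}`. -/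
def torPt (h : TemporalMetric U) (f : Fin m) (r : Fin n) (a b : Fin m) (j : Fin n)
    (e : JetCoord m n) : ℝ :=
  der N (pI b j) (N.N1 f r a) e + (if f = b then Ax N D j r a e else 0)
    - (if j = r then christoffel h f b a e.1 else 0)

/-- `torPx f r i b j = P^{(f) (j)}_{(r)i(b)}`. -/
def torPx (f : Fin m) (r i : Fin n) (b : Fin m) (j : Fin n) (e : JetCoord m n) : ℝ :=
  der N (pI b j) (N.N2 f r i) e + (if f = b then Hx N D j r i e else 0)

/-- `torS f r a i b j = S^{(f)(i)(j)}_{(r)(a)(b)}`. -/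
def torS (f : Fin m) (r : Fin n) (a : Fin m) (i : Fin n) (b : Fin m) (j : Fin n)
    (e : JetCoord m n) : ℝ :=
  -((if f = a then Cx N D i r b j e else 0) - (if f = b then Cx N D j r a i e else 0))

/-! The curvature d-tensors. -/

/-- `curRtt l i b c = R^l_{ibc}`. -/
def curRtt (l i : Fin n) (b c : Fin m) (e : JetCoord m n) : ℝ :=
  der N (tI c) (Ax N D l i b) e - der N (tI b) (Ax N D l i c) e
    + ∑ r, Ax N D r i b e * Ax N D l r c e - ∑ r, Ax N D r i c e * Ax N D l r b e
    + ∑ f, ∑ r, Cx N D l i f r e * torRtt N f r b c e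

/-- `curRtx l i b k = R^l_{ibk}`. -/
def curRtx (l i : Fin n) (b : Fin m) (k : Fin n) (e : JetCoord m n) : ℝ :=
  der N (xI k) (Ax N D l i b) e - der N (tI b) (Hx N D l i k) e
    + ∑ r, Ax N D r i b e * Hx N D l r k e - ∑ r, Hx N D r i k e * Ax N D l r b e
    + ∑ f, ∑ r, Cx N D l i f r e * torRtx N f r b k e

/-- `curRxx l i j k = R^l_{ijk}`. -/
def curRxx (l i j k : Fin n) (e : JetCoord m n) : ℝ :=
  der N (xI k) (Hx N D l i j) e - der N (xI j) (Hx N D l i k) e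
    + ∑ r, Hx N D r i j e * Hx N D l r k e - ∑ r, Hx N D r i k e * Hx N D l r j e
    + ∑ f, ∑ r, Cx N D l i f r e * torRxx N f r j k e

/-- `covCt l i c k b = C^{l(k)}_{i(c)/b}`. -/
def covCt (l i : Fin n) (c : Fin m) (k : Fin n) (b : Fin m) (e : JetCoord m n) : ℝ :=
  der N (tI b) (Cx N D l i c k) e + ∑ r, Cx N D r i c k e * Ax N D l r b e
    + ∑ f, ∑ r, Cx N D l i f r e * Ap N D f r c k b e - ∑ r, Cx N D l r c k e * Ax N D r i b e

/-- `covCx l i c k j = C^{l(k)}_{i(c)|j}`. -/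
def covCx (l i : Fin n) (c : Fin m) (k j : Fin n) (e : JetCoord m n) : ℝ :=
  der N (xI j) (Cx N D l i c k) e + ∑ r, Cx N D r i c k e * Hx N D l r j e
    + ∑ f, ∑ r, Cx N D l i f r e * Hp N D f r c k j e - ∑ r, Cx N D l r c k e * Hx N D r i j e

/-- `curPt h l i b c k = P^{l (k)}_{ib(c)}`. -/
def curPt (h : TemporalMetric U) (l i : Fin n) (b c : Fin m) (k : Fin n)
    (e : JetCoord m n) : ℝ :=
  der N (pI c k) (Ax N D l i b) e - covCt N D l i c k b e
    + ∑ f, ∑ r, Cx N D l i f r e * torPt N D h f r b c k e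

/-- `curPx l i j c k = P^{l (k)}_{ij(c)}`. -/
def curPx (l i j : Fin n) (c : Fin m) (k : Fin n) (e : JetCoord m n) : ℝ :=
  der N (pI c k) (Hx N D l i j) e - covCx N D l i c k j e
    + ∑ f, ∑ r, Cx N D l i f r e * torPx N D f r j c k e

/-- `curS l i b j c k = S^{l(j)(k)}_{i(b)(c)}`. -/
def curS (l i : Fin n) (b : Fin m) (j : Fin n) (c : Fin m) (k : Fin n) (e : JetCoord m n) : ℝ :=
  der N (pI c k) (Cx N D l i b j) e - der N (pI b j) (Cx N D l i c k) e
    + ∑ r, Cx N D r i b j e * Cx N D l r c k e - ∑ r, Cx N D r i c k e * Cx N D l r b j e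

end Adapted

end DualJet

end

open DualJet

namespace DualJet

variable {m n : ℕ} {U : Set (Fin m → ℝ)} {V : Set (Fin n → ℝ)}
  {N : NonlinearConnection U V} {D : JetConnection m n} {h : TemporalMetric U}

/-! All eighteen identities are components of one formula. In the adapted frame `Y_B`, the
commutator of second covariant derivatives is `X^F R^A_{FBC}` minus the first derivative of `X^A`
contracted with the torsion `T(Y_C, Y_B)` (`ricci_identity`). It follows from the product rule and
from `der_der_sub`, the commutator of `Y_B` and `Y_C` on functions. Each frame field is a constant
field plus vertical terms, so every bracket `[Y_C, Y_B]` is vertical; its components are those of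
`-anholonomy`.

What remains is to evaluate the curvature and the torsion block by block. Parallelism of the three
projections makes the coefficients, and hence the curvature, block diagonal.

The temporal block is the Levi-Civita connection of `h`. It depends on `t` alone and vanishes in the
directions `x` and `p`, so its only curvature is `chiCurv`.

The spatial block gives the listed curvature tensors, directly or after a cancellation.

For the vertical block, `D J = 0` says that `J` identifies the vertical distribution with (temporal)
⊗ (spatial dual) as bundles with connection. Hence `IsHNormal.Gam_pp`: a vertical coefficient is a
temporal one minus a transposed spatial one. The mixed products cancel on antisymmetrization, so the
curvature splits in the same way (`IsHNormal.curvature_pp`). This explains the negative spatial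
curvature and the extra `chiCurv` term in the v-identities.

In the torsion, symmetry of the Christoffel symbols removes the temporal part and the Cartan
symmetry of `H` removes the spatial part; `Gam_pp` turns the vertical part into the tensors `P` and
`S`. -/

theorem isOpen_jetDomain (hU : IsOpen U) (hV : IsOpen V) : IsOpen (jetDomain U V) :=
  (hU.preimage continuous_fst).inter (hV.preimage (continuous_fst.comp continuous_snd))

/-! ### Adapted frame and coframe -/

theorem sum_adapted {M : Type*} [AddCommMonoid M] (φ : AIdx m n → M) :
    ∑ F, φ F = ∑ a, φ (tI a) + (∑ i, φ (xI i) + ∑ a, ∑ i, φ (pI a i)) := by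
  rw [Fintype.sum_sum_type, Fintype.sum_sum_type, Fintype.sum_prod_type]

theorem coframe_frame (N : NonlinearConnection U V) (A B : AIdx m n) (e : JetCoord m n) :
    coframe N A e (frame N B e) = if A = B then 1 else 0 := by
  rcases A with a | i | ⟨a, i⟩ <;> rcases B with b | j | ⟨b, j⟩ <;>
    simp [coframe, frame, deltaT, deltaX, ddP, Pi.single_apply]
  · by_cases hij : i = j <;> by_cases hab : a = b <;> simp [hij, hab]

theorem sum_coframe_smul_frame (N : NonlinearConnection U V) (e v : JetCoord m n) :
    ∑ F, coframe N F e v • frame N F e = v := by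
  rw [sum_adapted]
  ext k
  · simp [coframe, frame, deltaT, deltaX, ddP, Prod.fst_sum, Pi.single_apply]
  · simp [coframe, frame, deltaT, deltaX, ddP, Prod.fst_sum, Prod.snd_sum, Pi.single_apply]
  · rename_i l
    simp only [coframe, frame, deltaT, deltaX, ddP, Prod.smul_mk, Prod.snd_add, Prod.snd_sum,
      Pi.add_apply, Finset.sum_apply, Pi.smul_apply, Pi.single_apply, smul_eq_mul]
    have key : ∑ a, ∑ i, (v.2.2 i a + ∑ b, N.N1 a i b e * v.1 b + ∑ j, N.N2 a i j e * v.2.1 j)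
        * (if k = i then (Pi.single a (1 : ℝ) : Fin m → ℝ) else 0) l
        = v.2.2 k l + ∑ b, N.N1 l k b e * v.1 b + ∑ j, N.N2 l k j e * v.2.1 j := by
      rw [Finset.sum_eq_single l, Finset.sum_eq_single k]
      · simp
      · intro i _ hi; simp [hi.symm]
      · simp
      · intro a _ ha
        refine Finset.sum_eq_zero fun i _ => ?_
        split_ifs <;> simp [ha.symm]
      · simp
    rw [show (∑ a, ∑ i, (v.2.2 i a + ∑ b, N.N1 a i b e * v.1 b + ∑ j, N.N2 a i j e * v.2.1 j)
        * (if k = i then (Pi.single a (1 : ℝ) : Fin m → ℝ) else 0) l) = _ from key]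
    simp only [mul_comm (v.1 _), mul_comm (v.2.1 _), neg_mul]
    rw [Finset.sum_neg_distrib, Finset.sum_neg_distrib]
    ring

/-- The coefficients of `-∂/∂p_r^f` in the adapted basis vector field `Y_B`. -/
def vertCoeff (N : NonlinearConnection U V) : AIdx m n → Fin m → Fin n → JetCoord m n → ℝ
  | Sum.inl a, f, r => N.N1 f r a
  | Sum.inr (Sum.inl i), f, r => N.N2 f r i
  | Sum.inr (Sum.inr _), _, _ => fun _ => 0

theorem contDiffOn_vertCoeff (B : AIdx m n) (f : Fin m) (r : Fin n) :
    ContDiffOn ℝ ∞ (vertCoeff N B f r) (jetDomain U V) := by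
  rcases B with a | i | ⟨a, i⟩
  exacts [N.smooth1 f r a, N.smooth2 f r i, contDiffOn_const]

/-- Only the vertical components of a frame field vary from point to point. This uniform description
of the three types of field gives smoothness and the brackets without a case split. -/
theorem frame_eq (B : AIdx m n) : ∃ c : JetCoord m n,
    frame N B = fun e => c - (0, 0, fun r f => vertCoeff N B f r e) := by
  rcases B with a | i | ⟨a, i⟩
  · exact ⟨(Pi.single a 1, 0, 0), by ext <;> simp [frame, deltaT, vertCoeff]⟩
  · exact ⟨(0, Pi.single i 1, 0), by ext <;> simp [frame, deltaX, vertCoeff]⟩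
  · exact ⟨(0, 0, Pi.single i (Pi.single a 1)), by ext <;> simp [frame, ddP, vertCoeff]⟩

theorem isSmoothField_frame (B : AIdx m n) : IsSmoothField (jetDomain U V) (frame N B) := by
  obtain ⟨c, hc⟩ := frame_eq (N := N) B
  rw [hc]
  refine contDiffOn_const.sub (contDiffOn_const.prodMk (contDiffOn_const.prodMk ?_))
  exact contDiffOn_pi.2 fun r => contDiffOn_pi.2 fun f => contDiffOn_vertCoeff B f r

theorem contDiffOn_coframe {Y : JetField m n} (hY : IsSmoothField (jetDomain U V) Y)
    (A : AIdx m n) : ContDiffOn ℝ ∞ (fun e => coframe N A e (Y e)) (jetDomain U V) := by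
  have h1 : ∀ a, ContDiffOn ℝ ∞ (fun e => (Y e).1 a) (jetDomain U V) := fun a =>
    contDiffOn_pi.1 (contDiff_fst.comp_contDiffOn hY) a
  have h2 : ∀ i, ContDiffOn ℝ ∞ (fun e => (Y e).2.1 i) (jetDomain U V) := fun i =>
    contDiffOn_pi.1 (contDiff_fst.comp_contDiffOn (contDiff_snd.comp_contDiffOn hY)) i
  have h3 : ∀ i a, ContDiffOn ℝ ∞ (fun e => (Y e).2.2 i a) (jetDomain U V) := fun i a =>
    contDiffOn_pi.1 (contDiffOn_pi.1
      (contDiff_snd.comp_contDiffOn (contDiff_snd.comp_contDiffOn hY)) i) a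
  rcases A with a | i | ⟨a, i⟩
  · exact h1 a
  · exact h2 i
  · exact ((h3 i a).add (ContDiffOn.sum fun b _ => (N.smooth1 a i b).mul (h1 b))).add
      (ContDiffOn.sum fun j _ => (N.smooth2 a i j).mul (h2 j))

/-! ### Smoothness of the coefficients and derivatives along the frame -/

theorem contDiffOn_covariantDerivative_apply {E : Type*} [NormedAddCommGroup E]
    [NormedSpace ℝ E] {s : Set E}
    {cov : (∀ x : E, TangentSpace 𝓘(ℝ, E) x) →
      (∀ x : E, TangentSpace 𝓘(ℝ, E) x →L[ℝ] TangentSpace 𝓘(ℝ, E) x)}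
    (hcov : ContMDiffCovariantDerivativeOn (I := 𝓘(ℝ, E)) E
      (V := fun x : E => TangentSpace 𝓘(ℝ, E) x) ∞ cov s)
    {Y Z : E → E} (hY : ContDiffOn ℝ ∞ Y s) (hZ : ContDiffOn ℝ ∞ Z s) :
    ContDiffOn ℝ ∞ (fun x => cov Y x (Z x)) s :=
  contMDiffOn_vectorSpace_iff_contDiffOn.1
    ((hcov.contMDiff (σ := Y) (contMDiffOn_vectorSpace_iff_contDiffOn.2 hY)).clm_bundle_apply
      (contMDiffOn_vectorSpace_iff_contDiffOn.2 hZ))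

theorem IsNLinear.contDiffOn_Gam (hD : IsNLinear N D) (F B C : AIdx m n) :
    ContDiffOn ℝ ∞ (Gam N D F B C) (jetDomain U V) :=
  contDiffOn_coframe (contDiffOn_covariantDerivative_apply hD.smooth
    (isSmoothField_frame B) (isSmoothField_frame C)) F

theorem differentiableAt_of_contDiffOn (hU : IsOpen U) (hV : IsOpen V) {E : Type*}
    [NormedAddCommGroup E] [NormedSpace ℝ E] {f : JetCoord m n → E}
    (hf : ContDiffOn ℝ ∞ f (jetDomain U V)) {e : JetCoord m n} (he : e ∈ jetDomain U V) :
    DifferentiableAt ℝ f e :=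
  (hf.contDiffAt ((isOpen_jetDomain hU hV).mem_nhds he)).differentiableAt (by simp)

theorem contDiffOn_der (hU : IsOpen U) (hV : IsOpen V) {f : JetCoord m n → ℝ}
    (hf : ContDiffOn ℝ ∞ f (jetDomain U V)) (C : AIdx m n) :
    ContDiffOn ℝ ∞ (der N C f) (jetDomain U V) :=
  (hf.fderiv_of_isOpen (isOpen_jetDomain hU hV) (by simp)).clm_apply (isSmoothField_frame C)

theorem der_congr (hU : IsOpen U) (hV : IsOpen V) {f g : JetCoord m n → ℝ}
    (hfg : ∀ e ∈ jetDomain U V, f e = g e) (C : AIdx m n) {e : JetCoord m n}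
    (he : e ∈ jetDomain U V) : der N C f e = der N C g e := by
  have : f =ᶠ[nhds e] g :=
    Filter.eventuallyEq_of_mem ((isOpen_jetDomain hU hV).mem_nhds he) hfg
  rw [der, der, this.fderiv_eq]

/-! ### Brackets of the frame and the general Ricci identity -/

/-- The vertical components of `-[Y_C, Y_B]` in the adapted basis. -/
noncomputable def anholonomy (N : NonlinearConnection U V) (f : Fin m) (r : Fin n) (B C : AIdx m n)
    (e : JetCoord m n) : ℝ :=
  der N C (vertCoeff N B f r) e - der N B (vertCoeff N C f r) e

theorem fderiv_frame (hU : IsOpen U) (hV : IsOpen V) (B : AIdx m n) {e : JetCoord m n}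
    (he : e ∈ jetDomain U V) (v : JetCoord m n) :
    fderiv ℝ (frame N B) e v = (0, 0, fun r f => -fderiv ℝ (vertCoeff N B f r) e v) := by
  obtain ⟨c, hc⟩ := frame_eq (N := N) B
  have hd : ∀ r f, HasFDerivAt (vertCoeff N B f r) (fderiv ℝ (vertCoeff N B f r) e) e :=
    fun r f => (differentiableAt_of_contDiffOn hU hV (contDiffOn_vertCoeff B f r) he).hasFDerivAt
  have h3 : HasFDerivAt (fun e' r f => vertCoeff N B f r e')
      (ContinuousLinearMap.pi fun r => ContinuousLinearMap.pi fun f =>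
        fderiv ℝ (vertCoeff N B f r) e) e :=
    hasFDerivAt_pi.2 fun r => hasFDerivAt_pi.2 fun f => hd r f
  have h4 := (((hasFDerivAt_const (0 : Fin m → ℝ) e).prodMk
    ((hasFDerivAt_const (0 : Fin n → ℝ) e).prodMk h3)).const_sub c).fderiv
  rw [hc, h4]
  ext <;> simp

/-- The constant parts of the frame fields drop out under differentiation, which leaves a vertical
vector; expanding it in the frame involves only the fields `∂/∂p`. -/
theorem lieBracket_frame (hU : IsOpen U) (hV : IsOpen V) (B C : AIdx m n) {e : JetCoord m n}
    (he : e ∈ jetDomain U V) :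
    VectorField.lieBracket ℝ (frame N C) (frame N B) e
      = -∑ f, ∑ r, anholonomy N f r B C e • frame N (pI f r) e := by
  rw [VectorField.lieBracket, fderiv_frame hU hV B he, fderiv_frame hU hV C he]
  have key := sum_coframe_smul_frame N e (0, 0, fun r f => anholonomy N f r B C e)
  rw [sum_adapted] at key
  simp only [coframe, Pi.zero_apply, zero_smul, Finset.sum_const_zero, mul_zero, add_zero,
    zero_add] at key
  rw [key]
  ext <;> simp [anholonomy, der]
  ring

theorem der_der_sub (hU : IsOpen U) (hV : IsOpen V) {φ : JetCoord m n → ℝ}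
    (hφ : ContDiffOn ℝ ∞ φ (jetDomain U V)) (B C : AIdx m n) {e : JetCoord m n}
    (he : e ∈ jetDomain U V) :
    der N C (der N B φ) e - der N B (der N C φ) e
      = -∑ f, ∑ r, anholonomy N f r B C e * der N (pI f r) φ e := by
  have hφ' := hφ.contDiffAt ((isOpen_jetDomain hU hV).mem_nhds he)
  have hb := VectorField.fderiv_apply_lieBracket hφ'
    -- Over `ℝ` symmetry of second derivatives needs only a finite order of smoothness, which lies
    -- below `∞`.
    (by rw [minSmoothness_of_isRCLikeNormedField]; exact WithTop.coe_le_coe.2 le_top)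
    (differentiableAt_of_contDiffOn hU hV (isSmoothField_frame (N := N) B) he)
    (differentiableAt_of_contDiffOn hU hV (isSmoothField_frame (N := N) C) he)
  rw [lieBracket_frame hU hV B C he] at hb
  simp only [map_neg, map_sum, map_smul, smul_eq_mul] at hb
  exact hb.symm

/-- The curvature of `D` in the adapted basis. -/
noncomputable def curvature (N : NonlinearConnection U V) (D : JetConnection m n) (A F B C : AIdx m n)
    (e : JetCoord m n) : ℝ :=
  der N C (Gam N D A F B) e - der N B (Gam N D A F C) e
    + ∑ G, Gam N D G F B e * Gam N D A G C e - ∑ G, Gam N D G F C e * Gam N D A G B e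
    + ∑ f, ∑ r, Gam N D A F (pI f r) e * anholonomy N f r B C e

theorem der_add {φ ψ : JetCoord m n → ℝ} {e : JetCoord m n} (hφ : DifferentiableAt ℝ φ e)
    (hψ : DifferentiableAt ℝ ψ e) (C : AIdx m n) :
    der N C (fun e => φ e + ψ e) e = der N C φ e + der N C ψ e := by
  rw [der, fderiv_fun_add hφ hψ]; rfl

theorem der_mul {φ ψ : JetCoord m n → ℝ} {e : JetCoord m n} (hφ : DifferentiableAt ℝ φ e)
    (hψ : DifferentiableAt ℝ ψ e) (C : AIdx m n) :
    der N C (fun e => φ e * ψ e) e = der N C φ e * ψ e + φ e * der N C ψ e := by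
  rw [der, fderiv_fun_mul hφ hψ]
  simp [der]; ring

theorem der_sum {ι : Type*} {s : Finset ι} {φ : ι → JetCoord m n → ℝ} {e : JetCoord m n}
    (hφ : ∀ i ∈ s, DifferentiableAt ℝ (φ i) e) (C : AIdx m n) :
    der N C (fun e => ∑ i ∈ s, φ i e) e = ∑ i ∈ s, der N C (φ i) e := by
  rw [der, fderiv_fun_sum hφ]
  simp [der]

theorem der_cov1 (hU : IsOpen U) (hV : IsOpen V) (hD : IsNLinear N D) {X : JetField m n}
    (hX : IsSmoothField (jetDomain U V) X) (A B C : AIdx m n) {e : JetCoord m n}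
    (he : e ∈ jetDomain U V) :
    der N C (cov1 N D X A B) e = der N C (der N B (comp N X A)) e
      + ∑ F, der N C (comp N X F) e * Gam N D A F B e
      + ∑ F, comp N X F e * der N C (Gam N D A F B) e := by
  have hG : ∀ F, DifferentiableAt ℝ (Gam N D A F B) e := fun F =>
    differentiableAt_of_contDiffOn hU hV (hD.contDiffOn_Gam A F B) he
  have hc : ∀ F, DifferentiableAt ℝ (comp N X F) e := fun F =>
    differentiableAt_of_contDiffOn hU hV (contDiffOn_coframe hX F) he
  have h1 : DifferentiableAt ℝ (der N B (comp N X A)) e :=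
    differentiableAt_of_contDiffOn hU hV (contDiffOn_der hU hV (contDiffOn_coframe hX A) B) he
  have h2 : ∀ F ∈ Finset.univ, DifferentiableAt ℝ (fun e => comp N X F e * Gam N D A F B e) e :=
    fun F _ => (hc F).fun_mul (hG F)
  calc der N C (cov1 N D X A B) e
      = der N C (fun e => der N B (comp N X A) e + ∑ F, comp N X F e * Gam N D A F B e) e := rfl
    _ = _ := by
      rw [der_add h1 (DifferentiableAt.fun_sum h2), der_sum h2, add_assoc,
        ← Finset.sum_add_distrib]
      congr 1
      exact Finset.sum_congr rfl fun F _ => der_mul (hc F) (hG F) C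

/-- The Ricci identity for the components of a vector field in the adapted basis. -/
theorem ricci_identity (hU : IsOpen U) (hV : IsOpen V) (hD : IsNLinear N D) {X : JetField m n}
    (hX : IsSmoothField (jetDomain U V) X) (A B C : AIdx m n) {e : JetCoord m n}
    (he : e ∈ jetDomain U V) :
    cov2 N D X A B C e - cov2 N D X A C B e
      = ∑ F, comp N X F e * curvature N D A F B C e
        - ∑ F, cov1 N D X A F e * (Gam N D F B C e - Gam N D F C B e)
        - ∑ f, ∑ r, cov1 N D X A (pI f r) e * anholonomy N f r B C e := by
  have hbr := der_der_sub (N := N) (φ := comp N X A) hU hV (contDiffOn_coframe hX A) B C he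
  rw [cov2, cov2, der_cov1 hU hV hD hX A B C he, der_cov1 hU hV hD hX A C B he]
  have e1 : ∀ B C : AIdx m n, ∑ F, cov1 N D X F B e * Gam N D A F C e
      = ∑ F, der N B (comp N X F) e * Gam N D A F C e
        + ∑ F, comp N X F e * ∑ G, Gam N D G F B e * Gam N D A G C e := by
    intro B C
    simp only [cov1, add_mul, Finset.sum_add_distrib, Finset.sum_mul, Finset.mul_sum]
    rw [Finset.sum_comm]
    simp only [mul_assoc]
  -- Replacing the plain derivative `∂X^A/∂p` from the bracket by the covariant one leaves a term
  -- `X^F Γ^A_{F(f)(r)}` times the anholonomy, which is the last summand of `curvature`.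
  have e2 : ∑ f, ∑ r, cov1 N D X A (pI f r) e * anholonomy N f r B C e
      = ∑ f, ∑ r, anholonomy N f r B C e * der N (pI f r) (comp N X A) e
        + ∑ F, comp N X F e * ∑ f, ∑ r, Gam N D A F (pI f r) e * anholonomy N f r B C e := by
    simp only [cov1, add_mul, Finset.sum_add_distrib, Finset.sum_mul, Finset.mul_sum]
    congr 1
    · simp only [mul_comm]
    · simp only [mul_assoc]
      exact (Finset.sum_congr rfl fun f _ => Finset.sum_comm).trans Finset.sum_comm
  have e3 : ∑ F, comp N X F e * curvature N D A F B C e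
      = ∑ F, comp N X F e * der N C (Gam N D A F B) e
        - ∑ F, comp N X F e * der N B (Gam N D A F C) e
        + ∑ F, comp N X F e * ∑ G, Gam N D G F B e * Gam N D A G C e
        - ∑ F, comp N X F e * ∑ G, Gam N D G F C e * Gam N D A G B e
        + ∑ F, comp N X F e * ∑ f, ∑ r, Gam N D A F (pI f r) e * anholonomy N f r B C e := by
    simp only [curvature, mul_add, mul_sub, Finset.sum_add_distrib, Finset.sum_sub_distrib]
  simp only [mul_sub, Finset.sum_sub_distrib]
  rw [e1 B C, e1 C B, e2, e3]
  linear_combination hbr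

/-! ### Parallel projections make the coefficients block diagonal -/

theorem isLinearMap_coframe (N : NonlinearConnection U V) (A : AIdx m n) (e : JetCoord m n) :
    IsLinearMap ℝ (coframe N A e) := by
  rcases A with a | i | ⟨a, i⟩
  · exact ⟨fun _ _ => rfl, fun _ _ => rfl⟩
  · exact ⟨fun _ _ => rfl, fun _ _ => rfl⟩
  · constructor
    · intro v w
      simp only [coframe, Prod.fst_add, Prod.snd_add, Pi.add_apply, mul_add,
        Finset.sum_add_distrib]
      ring
    · intro c v
      simp only [coframe, Prod.smul_fst, Prod.smul_snd, Pi.smul_apply, smul_eq_mul, mul_add,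
        Finset.mul_sum, mul_left_comm c]

theorem coframe_sum_smul_frame {ι : Type*} (s : Finset ι) (c : ι → ℝ) (σ : ι → AIdx m n)
    (A : AIdx m n) (e : JetCoord m n) :
    coframe N A e (∑ i ∈ s, c i • frame N (σ i) e) = ∑ i ∈ s, if A = σ i then c i else 0 := by
  refine (map_sum (isLinearMap_coframe N A e).mk' (fun i => c i • frame N (σ i) e) s).trans
    (Finset.sum_congr rfl fun i _ => ?_)
  rw [IsLinearMap.mk'_apply, (isLinearMap_coframe N A e).map_smul, coframe_frame]
  simp

theorem coframe_projT (A : AIdx m n) (e v : JetCoord m n) :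
    coframe N A e (projT N e v) = if A.isLeft then coframe N A e v else 0 := by
  have := coframe_sum_smul_frame (N := N) Finset.univ (fun a => coframe N (tI a) e v) tI A e
  refine this.trans ?_
  rcases A with a | i | ⟨a, i⟩ <;> simp [tI]

theorem coframe_projM (A : AIdx m n) (e v : JetCoord m n) :
    coframe N A e (projM N e v) = ∑ i, if A = xI i then coframe N (xI i) e v else 0 :=
  coframe_sum_smul_frame (N := N) Finset.univ (fun i => coframe N (xI i) e v) xI A e

theorem projV_eq (e v : JetCoord m n) :
    projV N e v = ∑ q : Fin m × Fin n, coframe N (pI q.1 q.2) e v • frame N (pI q.1 q.2) e := by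
  rw [projV, Fintype.sum_prod_type]; rfl

theorem coframe_projV (A : AIdx m n) (e v : JetCoord m n) :
    coframe N A e (projV N e v)
      = ∑ q : Fin m × Fin n, if A = pI q.1 q.2 then coframe N (pI q.1 q.2) e v else 0 := by
  rw [projV_eq]
  exact coframe_sum_smul_frame Finset.univ (fun q : Fin m × Fin n => coframe N (pI q.1 q.2) e v)
    (fun q => pI q.1 q.2) A e

theorem projT_frame (a : Fin m) (e : JetCoord m n) :
    projT N e (frame N (tI a) e) = frame N (tI a) e := by
  simp [projT, coframe_frame, tI]; rfl

theorem projM_frame (i : Fin n) (e : JetCoord m n) :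
    projM N e (frame N (xI i) e) = frame N (xI i) e := by
  simp [projM, coframe_frame, xI]; rfl

theorem projV_frame (a : Fin m) (i : Fin n) (e : JetCoord m n) :
    projV N e (frame N (pI a i) e) = frame N (pI a i) e := by
  rw [projV_eq, Finset.sum_eq_single (a, i)]
  · simp [coframe_frame]
  · rintro ⟨b, j⟩ - hb
    simp [coframe_frame, hb]
  · simp

namespace IsNLinear

/-- A temporal frame field is fixed by `h_T`, and `D` commutes with `h_T`, so its derivative is
fixed too and has no other components. The same argument with `h_M` and `v` gives the next two
lemmas. -/
theorem Gam_temporal (hD : IsNLinear N D) {e : JetCoord m n} (he : e ∈ jetDomain U V)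
    (A : AIdx m n) (b : Fin m) (C : AIdx m n) :
    Gam N D A (tI b) C e = if A.isLeft then Gam N D A (tI b) C e else 0 := by
  have := hD.projT_parallel _ (isSmoothField_frame (N := N) (tI b)) e he (frame N C e)
  simp only [projT_frame] at this
  conv_lhs => rw [Gam, this, coframe_projT]
  rfl

theorem Gam_spatial (hD : IsNLinear N D) {e : JetCoord m n} (he : e ∈ jetDomain U V)
    (A : AIdx m n) (j : Fin n) (C : AIdx m n) :
    Gam N D A (xI j) C e = ∑ i, if A = xI i then Gam N D (xI i) (xI j) C e else 0 := by
  have := hD.projM_parallel _ (isSmoothField_frame (N := N) (xI j)) e he (frame N C e)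
  simp only [projM_frame] at this
  conv_lhs => rw [Gam, this, coframe_projM]
  rfl

theorem Gam_vertical (hD : IsNLinear N D) {e : JetCoord m n} (he : e ∈ jetDomain U V)
    (A : AIdx m n) (b : Fin m) (j : Fin n) (C : AIdx m n) :
    Gam N D A (pI b j) C e
      = ∑ q : Fin m × Fin n, if A = pI q.1 q.2 then Gam N D (pI q.1 q.2) (pI b j) C e else 0 := by
  have := hD.projV_parallel _ (isSmoothField_frame (N := N) (pI b j)) e he (frame N C e)
  simp only [projV_frame] at this
  conv_lhs => rw [Gam, this, coframe_projV]
  rfl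

theorem Gam_xt (hD : IsNLinear N D) {e : JetCoord m n} (he : e ∈ jetDomain U V)
    (i : Fin n) (b : Fin m) (C : AIdx m n) : Gam N D (xI i) (tI b) C e = 0 := by
  rw [hD.Gam_temporal he]; simp

theorem Gam_pt (hD : IsNLinear N D) {e : JetCoord m n} (he : e ∈ jetDomain U V)
    (a : Fin m) (i : Fin n) (b : Fin m) (C : AIdx m n) :
    Gam N D (pI a i) (tI b) C e = 0 := by
  rw [hD.Gam_temporal he]; simp

theorem Gam_tx (hD : IsNLinear N D) {e : JetCoord m n} (he : e ∈ jetDomain U V)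
    (a : Fin m) (j : Fin n) (C : AIdx m n) : Gam N D (tI a) (xI j) C e = 0 := by
  rw [hD.Gam_spatial he]; simp

theorem Gam_px (hD : IsNLinear N D) {e : JetCoord m n} (he : e ∈ jetDomain U V)
    (a : Fin m) (i j : Fin n) (C : AIdx m n) :
    Gam N D (pI a i) (xI j) C e = 0 := by
  rw [hD.Gam_spatial he]; simp

theorem Gam_tp (hD : IsNLinear N D) {e : JetCoord m n} (he : e ∈ jetDomain U V)
    (a b : Fin m) (j : Fin n) (C : AIdx m n) :
    Gam N D (tI a) (pI b j) C e = 0 := by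
  rw [hD.Gam_vertical he]; simp

theorem Gam_xp (hD : IsNLinear N D) {e : JetCoord m n} (he : e ∈ jetDomain U V)
    (i : Fin n) (b : Fin m) (j : Fin n) (C : AIdx m n) :
    Gam N D (xI i) (pI b j) C e = 0 := by
  rw [hD.Gam_vertical he]; simp

end IsNLinear

/-! ### The Levi-Civita connection of the temporal metric -/

/-- Contraction with the metric cancels the inverse metric and leaves the Christoffel symbols of the
first kind. -/
theorem sum_mul_christoffel (h : TemporalMetric U) {t : Fin m → ℝ} (ht : t ∈ U)
    (a b c : Fin m) :
    ∑ d, h.g t a d * christoffel h d b c t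
      = (1 / 2) * (dT b (fun s => h.g s a c) t + dT c (fun s => h.g s a b) t
        - dT a (fun s => h.g s b c) t) := by
  have hinv : h.g t * (h.g t)⁻¹ = 1 := Matrix.mul_nonsing_inv _ (h.nondeg t ht).isUnit
  have hk : ∀ k, ∑ d, h.g t a d * (h.g t)⁻¹ d k = if a = k then 1 else 0 := fun k => by
    rw [← Matrix.mul_apply, hinv, Matrix.one_apply]
  set L : Fin m → ℝ := fun k => dT b (fun s => h.g s k c) t + dT c (fun s => h.g s k b) t
        - dT k (fun s => h.g s b c) t with hL
  calc ∑ d, h.g t a d * christoffel h d b c t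
      = ∑ k, (1 / 2) * ((∑ d, h.g t a d * (h.g t)⁻¹ d k) * L k) := by
        simp only [christoffel, Finset.mul_sum, Finset.sum_mul]
        rw [Finset.sum_comm]
        refine Finset.sum_congr rfl fun k _ => Finset.sum_congr rfl fun d _ => ?_
        simp only [hL]; ring
    _ = _ := by simp [hk, hL]

theorem dT_metric_symm (hU : IsOpen U) (h : TemporalMetric U) {t : Fin m → ℝ} (ht : t ∈ U)
    (a b c : Fin m) : dT c (fun s => h.g s a b) t = dT c (fun s => h.g s b a) t := by
  have : (fun s => h.g s a b) =ᶠ[nhds t] fun s => h.g s b a :=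
    Filter.eventuallyEq_of_mem (hU.mem_nhds ht) fun s hs => (h.symm s hs).apply b a
  rw [dT, dT, this.fderiv_eq]

theorem christoffel_symm (hU : IsOpen U) (h : TemporalMetric U) {t : Fin m → ℝ} (ht : t ∈ U)
    (a b c : Fin m) : christoffel h a b c t = christoffel h a c b t := by
  simp only [christoffel]
  congr 1
  refine Finset.sum_congr rfl fun d _ => ?_
  rw [dT_metric_symm hU h ht b c d]
  ring

/-- The Levi-Civita connection is metric. -/
theorem dT_metric (hU : IsOpen U) (h : TemporalMetric U) {t : Fin m → ℝ} (ht : t ∈ U)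
    (a b c : Fin m) :
    dT c (fun s => h.g s a b) t = ∑ d, christoffel h d a c t * h.g t d b
      + ∑ d, christoffel h d b c t * h.g t a d := by
  have h1 := sum_mul_christoffel h ht a b c
  have h2 := sum_mul_christoffel h ht b a c
  have e1 : ∑ d, christoffel h d b c t * h.g t a d = ∑ d, h.g t a d * christoffel h d b c t :=
    Finset.sum_congr rfl fun d _ => mul_comm _ _
  have e2 : ∑ d, christoffel h d a c t * h.g t d b = ∑ d, h.g t b d * christoffel h d a c t :=
    Finset.sum_congr rfl fun d _ => by rw [(h.symm t ht).apply b d, mul_comm]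
  rw [e1, e2, h1, h2, dT_metric_symm hU h ht b a, dT_metric_symm hU h ht b c,
    dT_metric_symm hU h ht a c]
  ring

/-! ### The condition `D J = 0` and the vertical coefficients -/

theorem der_comp_fst {φ : (Fin m → ℝ) → ℝ} {e : JetCoord m n}
    (hφ : DifferentiableAt ℝ φ e.1) (C : AIdx m n) :
    der N C (fun e' => φ e'.1) e = fderiv ℝ φ e.1 (frame N C e).1 := by
  have := (hφ.hasFDerivAt.comp e hasFDerivAt_fst).fderiv
  rw [der, show (fun e' : JetCoord m n => φ e'.1) = φ ∘ Prod.fst from rfl, this]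
  rfl

theorem hNormalization_apply_frame_tx (b : Fin m) (j : Fin n) (e v : JetCoord m n) :
    hNormalization N h e v (frame N (tI b) e) (frame N (xI j) e)
      = ∑ d, h.g e.1 d b * coframe N (pI d j) e v := by
  simp [hNormalization, coframe_frame, tI, xI]

theorem hNormalization_apply_frame_px (a : Fin m) (i j : Fin n) (e u : JetCoord m n) :
    hNormalization N h e (frame N (pI a i) e) u (frame N (xI j) e)
      = if i = j then ∑ d, h.g e.1 a d * coframe N (tI d) e u else 0 := by
  simp only [hNormalization, coframe_frame, tI, xI, pI, Sum.inr.injEq, Sum.inl.injEq,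
    Prod.mk.injEq, mul_ite, mul_one, mul_zero, Finset.sum_ite_eq', Finset.mem_univ, if_true]
  rw [Finset.sum_eq_single a]
  · by_cases hij : i = j <;> simp [hij, eq_comm]
  · intro d _ hd; simp [hd]
  · simp

theorem hNormalization_apply_frame_pt (a b : Fin m) (i : Fin n) (e w : JetCoord m n) :
    hNormalization N h e (frame N (pI a i) e) (frame N (tI b) e) w
      = h.g e.1 a b * coframe N (xI i) e w := by
  simp only [hNormalization, coframe_frame, tI, pI, Sum.inr.injEq, Sum.inl.injEq,
    Prod.mk.injEq]
  rw [Finset.sum_eq_single a, Finset.sum_eq_single b, Finset.sum_eq_single i]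
  · simp
  · intro k _ hk; simp [hk]
  · simp
  · intro d _ hd; simp [hd]
  · simp
  · intro d _ hd; simp [hd]
  · simp

namespace IsHNormal

/-- Along `δ/δt^c` this is metricity of the Levi-Civita connection. In the other directions both
sides vanish: `h` depends on `t` only, and the temporal coefficients are zero there. -/
theorem der_metric (hU : IsOpen U) (hD : IsHNormal N D h) (a b : Fin m) (C : AIdx m n)
    {e : JetCoord m n} (he : e ∈ jetDomain U V) :
    der N C (fun e' => h.g e'.1 a b) e
      = ∑ d, Gam N D (tI d) (tI a) C e * h.g e.1 d b
        + ∑ d, Gam N D (tI d) (tI b) C e * h.g e.1 a d := by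
  have hdiff : DifferentiableAt ℝ (fun t => h.g t a b) e.1 :=
    ((h.smooth a b).contDiffAt (hU.mem_nhds he.1)).differentiableAt (by simp)
  rw [der_comp_fst (φ := fun t => h.g t a b) hdiff]
  rcases C with c | k | ⟨c, k⟩
  · have hA : ∀ d b, Gam N D (tI d) (tI b) (tI c) e = christoffel h d b c e.1 :=
      fun d b => hD.At_eq d b c e he
    simp only [hA]
    exact dT_metric hU h he.1 a b c
  · have hH : ∀ d b, Gam N D (tI d) (tI b) (xI k) e = 0 := fun d b => hD.Ht_eq d b k e he
    simp [hH, frame, deltaX]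
  · have hC : ∀ d b, Gam N D (tI d) (tI b) (pI c k) e = 0 := fun d b => hD.Ct_eq d b c k e he
    simp [hC, frame, ddP]

/-- For an `h`-normal connection the vertical coefficients are determined by the horizontal
ones. -/
theorem Gam_pp (hU : IsOpen U) (hD : IsHNormal N D h) (a b : Fin m) (i j : Fin n)
    (C : AIdx m n) {e : JetCoord m n} (he : e ∈ jetDomain U V) :
    Gam N D (pI a i) (pI b j) C e
      = (if i = j then Gam N D (tI a) (tI b) C e else 0)
        - (if a = b then Gam N D (xI j) (xI i) C e else 0) := by
  -- The defect of the claimed formula, as a vector in the upper temporal index, is annihilated by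
  -- the nondegenerate metric.
  have key : (fun d => Gam N D (pI d i) (pI b j) C e
      - ((if i = j then Gam N D (tI d) (tI b) C e else 0)
        - (if d = b then Gam N D (xI j) (xI i) C e else 0))) = 0 := by
    refine Matrix.eq_zero_of_vecMul_eq_zero (h.nondeg e.1 he.1) (funext fun c => ?_)
    -- On the triple `∂/∂p_j^b`, `δ/δt^c`, `δ/δx^i` the tensor `J` equals `h_{bc} δ_{ij}`. By
    -- metricity, its derivative absorbs the term in which `D` acts on `δ/δt^c`.
    have hJ := hD.J_parallel _ _ _ (isSmoothField_frame (N := N) (pI b j))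
      (isSmoothField_frame (N := N) (tI c)) (isSmoothField_frame (N := N) (xI i)) e he
      (frame N C e)
    simp only [hNormalization_apply_frame_tx, hNormalization_apply_frame_pt,
      hNormalization_apply_frame_px, coframe_frame] at hJ
    have hm := hD.der_metric hU b c C he
    have hfun : (fun e' : JetCoord m n => ∑ d, h.g e'.1 d c * if pI d i = pI (n := n) b j
        then (1 : ℝ) else 0) = if i = j then fun e' => h.g e'.1 b c else fun _ => 0 := by
      ext e'
      by_cases hij : i = j <;> simp [pI, hij]
    rw [hfun] at hJ
    change _ - (∑ d, h.g e.1 d c * Gam N D (pI d i) (pI b j) C e)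
      - (if j = i then ∑ d, h.g e.1 b d * Gam N D (tI d) (tI c) C e else 0)
      - h.g e.1 b c * Gam N D (xI j) (xI i) C e = 0 at hJ
    simp only [Matrix.vecMul, dotProduct, sub_mul, Finset.sum_sub_distrib, Pi.zero_apply,
      ite_mul, zero_mul, Finset.sum_ite_eq', Finset.mem_univ, if_true]
    have e1 : ∑ d, Gam N D (tI d) (tI c) C e * h.g e.1 b d
        = ∑ d, h.g e.1 b d * Gam N D (tI d) (tI c) C e :=
      Finset.sum_congr rfl fun d _ => mul_comm _ _
    have e2 : ∑ d, Gam N D (pI d i) (pI b j) C e * h.g e.1 d c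
        = ∑ d, h.g e.1 d c * Gam N D (pI d i) (pI b j) C e :=
      Finset.sum_congr rfl fun d _ => mul_comm _ _
    rw [e1] at hm
    rw [e2]
    by_cases hij : i = j
    · subst hij
      simp only [if_true] at hJ ⊢
      change der N C (fun e' => h.g e'.1 b c) e - _ - _ - _ = 0 at hJ
      rw [hm] at hJ
      linear_combination -hJ
    · have hji : ¬ j = i := fun hji => hij hji.symm
      simp only [if_neg hij, if_neg hji, Finset.sum_const_zero] at hJ ⊢
      have h0 : fderiv ℝ (fun _ : JetCoord m n => (0 : ℝ)) e (frame N C e) = 0 := by simp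
      rw [h0] at hJ
      linear_combination -hJ
  have := congrFun key a
  simp only [Pi.zero_apply, sub_eq_zero] at this
  exact this

end IsHNormal

/-! ### Curvature blocks -/

theorem der_eq_zero (hU : IsOpen U) (hV : IsOpen V) {φ : JetCoord m n → ℝ}
    (hφ : ∀ e ∈ jetDomain U V, φ e = 0) (C : AIdx m n) {e : JetCoord m n}
    (he : e ∈ jetDomain U V) : der N C φ e = 0 := by
  rw [der_congr (g := fun _ => 0) hU hV hφ C he]
  simp [der]

/-- For an off-diagonal pair the coefficient vanishes on the whole open domain, hence so do its
derivatives, and every product through an intermediate index contains an off-diagonal factor. -/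
theorem curvature_eq_zero (hU : IsOpen U) (hV : IsOpen V) {A F : AIdx m n} {e : JetCoord m n}
    (he : e ∈ jetDomain U V) (h1 : ∀ C, ∀ e ∈ jetDomain U V, Gam N D A F C e = 0)
    (h2 : ∀ G B C, Gam N D G F B e * Gam N D A G C e = 0) (B C : AIdx m n) :
    curvature N D A F B C e = 0 := by
  simp [curvature, der_eq_zero hU hV (h1 _) _ he, h2, h1 _ e he]

namespace IsNLinear

theorem curvature_xt (hU : IsOpen U) (hV : IsOpen V) (hD : IsNLinear N D) {e : JetCoord m n}
    (he : e ∈ jetDomain U V) (i : Fin n) (b : Fin m) (B C : AIdx m n) :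
    curvature N D (xI i) (tI b) B C e = 0 := by
  refine curvature_eq_zero hU hV he (fun C e he => hD.Gam_xt he i b C) (fun G B C => ?_) B C
  rcases G with d | k | ⟨d, k⟩
  · rw [hD.Gam_xt he i d, mul_zero]
  · rw [hD.Gam_xt he k b, zero_mul]
  · rw [hD.Gam_pt he d k b, zero_mul]

theorem curvature_pt (hU : IsOpen U) (hV : IsOpen V) (hD : IsNLinear N D) {e : JetCoord m n}
    (he : e ∈ jetDomain U V) (a : Fin m) (i : Fin n) (b : Fin m) (B C : AIdx m n) :
    curvature N D (pI a i) (tI b) B C e = 0 := by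
  refine curvature_eq_zero hU hV he (fun C e he => hD.Gam_pt he a i b C) (fun G B C => ?_) B C
  rcases G with d | k | ⟨d, k⟩
  · rw [hD.Gam_pt he a i d, mul_zero]
  · rw [hD.Gam_xt he k b, zero_mul]
  · rw [hD.Gam_pt he d k b, zero_mul]

theorem curvature_tx (hU : IsOpen U) (hV : IsOpen V) (hD : IsNLinear N D) {e : JetCoord m n}
    (he : e ∈ jetDomain U V) (a : Fin m) (j : Fin n) (B C : AIdx m n) :
    curvature N D (tI a) (xI j) B C e = 0 := by
  refine curvature_eq_zero hU hV he (fun C e he => hD.Gam_tx he a j C) (fun G B C => ?_) B C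
  rcases G with d | k | ⟨d, k⟩
  · rw [hD.Gam_tx he d j, zero_mul]
  · rw [hD.Gam_tx he a k, mul_zero]
  · rw [hD.Gam_px he d k j, zero_mul]

theorem curvature_px (hU : IsOpen U) (hV : IsOpen V) (hD : IsNLinear N D) {e : JetCoord m n}
    (he : e ∈ jetDomain U V) (a : Fin m) (i j : Fin n) (B C : AIdx m n) :
    curvature N D (pI a i) (xI j) B C e = 0 := by
  refine curvature_eq_zero hU hV he (fun C e he => hD.Gam_px he a i j C) (fun G B C => ?_) B C
  rcases G with d | k | ⟨d, k⟩
  · rw [hD.Gam_tx he d j, zero_mul]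
  · rw [hD.Gam_px he a i k, mul_zero]
  · rw [hD.Gam_px he d k j, zero_mul]

theorem curvature_tp (hU : IsOpen U) (hV : IsOpen V) (hD : IsNLinear N D) {e : JetCoord m n}
    (he : e ∈ jetDomain U V) (a b : Fin m) (j : Fin n) (B C : AIdx m n) :
    curvature N D (tI a) (pI b j) B C e = 0 := by
  refine curvature_eq_zero hU hV he (fun C e he => hD.Gam_tp he a b j C) (fun G B C => ?_) B C
  rcases G with d | k | ⟨d, k⟩
  · rw [hD.Gam_tp he d b j, zero_mul]
  · rw [hD.Gam_xp he k b j, zero_mul]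
  · rw [hD.Gam_tp he a d k, mul_zero]

theorem curvature_xp (hU : IsOpen U) (hV : IsOpen V) (hD : IsNLinear N D) {e : JetCoord m n}
    (he : e ∈ jetDomain U V) (i : Fin n) (b : Fin m) (j : Fin n) (B C : AIdx m n) :
    curvature N D (xI i) (pI b j) B C e = 0 := by
  refine curvature_eq_zero hU hV he (fun C e he => hD.Gam_xp he i b j C) (fun G B C => ?_) B C
  rcases G with d | k | ⟨d, k⟩
  · rw [hD.Gam_tp he d b j, zero_mul]
  · rw [hD.Gam_xp he k b j, zero_mul]
  · rw [hD.Gam_xp he i d k, mul_zero]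

theorem curvature_tt (hD : IsNLinear N D) {e : JetCoord m n}
    (he : e ∈ jetDomain U V) (a b : Fin m) (B C : AIdx m n) :
    curvature N D (tI a) (tI b) B C e
      = der N C (Gam N D (tI a) (tI b) B) e - der N B (Gam N D (tI a) (tI b) C) e
        + ∑ d, Gam N D (tI d) (tI b) B e * Gam N D (tI a) (tI d) C e
        - ∑ d, Gam N D (tI d) (tI b) C e * Gam N D (tI a) (tI d) B e
        + ∑ f, ∑ r, Gam N D (tI a) (tI b) (pI f r) e * anholonomy N f r B C e := by
  simp [curvature, hD.Gam_xt he, hD.Gam_pt he]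

theorem curvature_xx (hD : IsNLinear N D) {e : JetCoord m n}
    (he : e ∈ jetDomain U V) (i j : Fin n) (B C : AIdx m n) :
    curvature N D (xI i) (xI j) B C e
      = der N C (Gam N D (xI i) (xI j) B) e - der N B (Gam N D (xI i) (xI j) C) e
        + ∑ k, Gam N D (xI k) (xI j) B e * Gam N D (xI i) (xI k) C e
        - ∑ k, Gam N D (xI k) (xI j) C e * Gam N D (xI i) (xI k) B e
        + ∑ f, ∑ r, Gam N D (xI i) (xI j) (pI f r) e * anholonomy N f r B C e := by
  simp [curvature, hD.Gam_tx he, hD.Gam_px he]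

end IsNLinear

/-- This is the product of two operators of the form `t ⊗ 1 - 1 ⊗ xᵀ`. The two mixed terms become
symmetric when both operators come from the same connection in two directions; the spatial product
appears in reversed order because of the dual. -/
theorem sum_vertical_product (a b : Fin m) (i j : Fin n) (t s : Fin m → Fin m → ℝ)
    (x y : Fin n → Fin n → ℝ) :
    ∑ d, ∑ k, ((if k = j then t d b else 0) - (if d = b then x j k else 0))
        * ((if i = k then s a d else 0) - (if a = d then y k i else 0))
      = (if i = j then ∑ d, t d b * s a d else 0) - t a b * y j i - x j i * s a b
        + (if a = b then ∑ k, x j k * y k i else 0) := by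
  simp only [sub_mul, mul_sub, Finset.sum_sub_distrib, ite_mul, mul_ite, zero_mul, mul_zero,
    Finset.sum_ite_eq, Finset.sum_ite_eq', Finset.mem_univ, if_true]
  have e1 : ∑ d, (if i = j then t d b * s a d else 0)
      = if i = j then ∑ d, t d b * s a d else 0 := by split_ifs <;> simp
  have e2 : ∑ d, ∑ k, (if a = d then
      (if k = j then t d b * y k i else 0) - (if d = b then x j k * y k i else 0) else 0)
      = t a b * y j i - if a = b then ∑ k, x j k * y k i else 0 := by
    rw [Finset.sum_eq_single a]
    · by_cases hab : a = b <;> simp [hab]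
    · simp +contextual [eq_comm]
    · simp
  rw [e1, e2]
  ring

theorem der_sub {φ ψ : JetCoord m n → ℝ} {e : JetCoord m n} (hφ : DifferentiableAt ℝ φ e)
    (hψ : DifferentiableAt ℝ ψ e) (C : AIdx m n) :
    der N C (fun e => φ e - ψ e) e = der N C φ e - der N C ψ e := by
  rw [der, fderiv_fun_sub hφ hψ]; rfl

namespace IsHNormal

theorem der_Gam_pp (hU : IsOpen U) (hV : IsOpen V) (hD : IsHNormal N D h) (a b : Fin m)
    (i j : Fin n) (B C : AIdx m n) {e : JetCoord m n} (he : e ∈ jetDomain U V) :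
    der N C (Gam N D (pI a i) (pI b j) B) e
      = (if i = j then der N C (Gam N D (tI a) (tI b) B) e else 0)
        - (if a = b then der N C (Gam N D (xI j) (xI i) B) e else 0) := by
  have hz : der N C (fun _ => 0) e = 0 := by simp [der]
  have hd : ∀ A F, DifferentiableAt ℝ (Gam N D A F B) e := fun A F =>
    differentiableAt_of_contDiffOn hU hV (hD.nlinear.contDiffOn_Gam A F B) he
  rw [der_congr hU hV (fun e he => hD.Gam_pp hU a b i j B he) C he]
  by_cases hij : i = j <;> by_cases hab : a = b <;> simp only [hij, hab, if_true, if_false]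
  · exact der_sub (hd _ _) (hd _ _) C
  · simp only [sub_zero]
  · rw [der_sub (differentiableAt_const _) (hd _ _), hz]
  · simpa using hz

/-- The curvature of a tensor product with a dual bundle: the mixed terms are symmetric in `B` and
`C` and cancel, while the reversed order of the spatial products supplies the minus sign. -/
theorem curvature_pp (hU : IsOpen U) (hV : IsOpen V) (hD : IsHNormal N D h) (a b : Fin m)
    (i j : Fin n) (B C : AIdx m n) {e : JetCoord m n} (he : e ∈ jetDomain U V) :
    curvature N D (pI a i) (pI b j) B C e
      = (if i = j then curvature N D (tI a) (tI b) B C e else 0)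
        - (if a = b then curvature N D (xI j) (xI i) B C e else 0) := by
  have hq : ∀ B C : AIdx m n,
      ∑ G, Gam N D G (pI b j) B e * Gam N D (pI a i) G C e
        = (if i = j then ∑ d, Gam N D (tI d) (tI b) B e * Gam N D (tI a) (tI d) C e else 0)
          - Gam N D (tI a) (tI b) B e * Gam N D (xI j) (xI i) C e
          - Gam N D (xI j) (xI i) B e * Gam N D (tI a) (tI b) C e
          + (if a = b then ∑ k, Gam N D (xI j) (xI k) B e * Gam N D (xI k) (xI i) C e
            else 0) := by
    intro B C
    rw [sum_adapted]
    simp only [hD.nlinear.Gam_pt he, hD.nlinear.Gam_px he, mul_zero, Finset.sum_const_zero,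
      zero_add, hD.Gam_pp hU _ _ _ _ _ he]
    exact sum_vertical_product a b i j (fun d b => Gam N D (tI d) (tI b) B e)
      (fun d b => Gam N D (tI d) (tI b) C e) (fun i k => Gam N D (xI i) (xI k) B e)
      (fun i k => Gam N D (xI i) (xI k) C e)
  have hx : ∀ B C : AIdx m n, ∑ k, Gam N D (xI k) (xI i) B e * Gam N D (xI j) (xI k) C e
      = ∑ k, Gam N D (xI j) (xI k) C e * Gam N D (xI k) (xI i) B e := fun B C =>
    Finset.sum_congr rfl fun k _ => mul_comm _ _
  rw [hD.nlinear.curvature_tt he, hD.nlinear.curvature_xx he, hx B C, hx C B, curvature,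
    hq B C, hq C B, hD.der_Gam_pp hU hV a b i j B C he, hD.der_Gam_pp hU hV a b i j C B he]
  simp only [hD.Gam_pp hU _ _ _ _ _ he, sub_mul, Finset.sum_sub_distrib]
  by_cases hij : i = j <;> by_cases hab : a = b <;>
    simp only [hij, hab, if_true, if_false, zero_mul, Finset.sum_const_zero] <;> ring

end IsHNormal

/-! ### Identification of curvature and torsion with the local d-tensors -/

namespace IsHNormal

theorem der_Gam_ttt (hU : IsOpen U) (hV : IsOpen V) (hD : IsHNormal N D h) (a b c : Fin m)
    (C : AIdx m n) {e : JetCoord m n} (he : e ∈ jetDomain U V) :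
    der N C (Gam N D (tI a) (tI b) (tI c)) e
      = fderiv ℝ (christoffel h a b c) e.1 (frame N C e).1 := by
  -- Near `e.1` the Christoffel symbol is the restriction of the smooth coefficient `A^a_{bc}` to
  -- the slice with `x` and `p` frozen, and inherits its differentiability.
  have hdiff : DifferentiableAt ℝ (christoffel h a b c) e.1 := by
    have hG : DifferentiableAt ℝ (Gam N D (tI a) (tI b) (tI c)) (e.1, e.2) :=
      differentiableAt_of_contDiffOn hU hV (hD.nlinear.contDiffOn_Gam _ _ _) he
    have hι : DifferentiableAt ℝ (fun t : Fin m → ℝ => (t, e.2)) e.1 :=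
      differentiableAt_id.prodMk (differentiableAt_const _)
    refine (DifferentiableAt.comp (f := fun t : Fin m → ℝ => (t, e.2)) e.1 hG hι).congr_of_eventuallyEq ?_
    refine Filter.eventuallyEq_of_mem (hU.mem_nhds he.1) fun t ht => ?_
    exact (hD.At_eq a b c (t, e.2) ⟨ht, he.2⟩).symm
  rw [der_congr (f := Gam N D (tI a) (tI b) (tI c)) hU hV (hD.At_eq a b c) C he]
  exact der_comp_fst hdiff C

theorem curvature_tt_tt (hU : IsOpen U) (hV : IsOpen V) (hD : IsHNormal N D h)
    {e : JetCoord m n} (he : e ∈ jetDomain U V) (a f b c : Fin m) :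
    curvature N D (tI a) (tI f) (tI b) (tI c) e = chiCurv h a f b c e.1 := by
  have hA : ∀ d b c, Gam N D (tI d) (tI b) (tI c) e = christoffel h d b c e.1 :=
    fun d b c => hD.At_eq d b c e he
  have hC : ∀ d b c k, Gam N D (tI d) (tI b) (pI c k) e = 0 := fun d b c k =>
    hD.Ct_eq d b c k e he
  rw [hD.nlinear.curvature_tt he, hD.der_Gam_ttt hU hV _ _ _ _ he,
    hD.der_Gam_ttt hU hV _ _ _ _ he]
  simp only [hA, hC, zero_mul, Finset.sum_const_zero, add_zero]
  rfl

theorem Gam_tt_inr (hD : IsHNormal N D h) {e : JetCoord m n} (he : e ∈ jetDomain U V)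
    (a b : Fin m) (C : Fin n ⊕ Fin m × Fin n) :
    Gam N D (tI a) (tI b) (Sum.inr C) e = 0 := by
  rcases C with k | ⟨c, k⟩
  exacts [hD.Ht_eq a b k e he, hD.Ct_eq a b c k e he]

/-- The temporal curvature of an `h`-normal connection vanishes on planes that are not temporal. -/
theorem curvature_tt_inr (hU : IsOpen U) (hV : IsOpen V) (hD : IsHNormal N D h)
    {e : JetCoord m n} (he : e ∈ jetDomain U V) (a f : Fin m) (B : AIdx m n)
    (C : Fin n ⊕ Fin m × Fin n) :
    curvature N D (tI a) (tI f) B (Sum.inr C) e = 0 := by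
  have h1 : der N (Sum.inr C) (Gam N D (tI a) (tI f) B) e = 0 := by
    rcases B with b | B
    · rw [hD.der_Gam_ttt hU hV a f b _ he]
      rcases C with k | ⟨c, k⟩ <;> simp [frame, deltaX, ddP]
    · exact der_eq_zero hU hV (fun e he => hD.Gam_tt_inr he a f B) _ he
  have h2 : der N B (Gam N D (tI a) (tI f) (Sum.inr C)) e = 0 :=
    der_eq_zero hU hV (fun e he => hD.Gam_tt_inr he a f C) _ he
  simp only [hD.nlinear.curvature_tt he, h1, h2, hD.Gam_tt_inr he, mul_zero, zero_mul,
    Finset.sum_const_zero, sub_zero, add_zero]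

theorem curvature_xx_tt (hD : IsHNormal N D h) {e : JetCoord m n} (he : e ∈ jetDomain U V)
    (i l : Fin n) (b c : Fin m) :
    curvature N D (xI l) (xI i) (tI b) (tI c) e = curRtt N D l i b c e :=
  hD.nlinear.curvature_xx he _ _ _ _

theorem curvature_xx_tx (hD : IsHNormal N D h) {e : JetCoord m n} (he : e ∈ jetDomain U V)
    (i l : Fin n) (b : Fin m) (k : Fin n) :
    curvature N D (xI l) (xI i) (tI b) (xI k) e = curRtx N D l i b k e :=
  hD.nlinear.curvature_xx he _ _ _ _

theorem curvature_xx_xx (hD : IsHNormal N D h) {e : JetCoord m n} (he : e ∈ jetDomain U V)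
    (i l j k : Fin n) :
    curvature N D (xI l) (xI i) (xI j) (xI k) e = curRxx N D l i j k e :=
  hD.nlinear.curvature_xx he _ _ _ _

theorem anholonomy_pI (N : NonlinearConnection U V) (f : Fin m) (r : Fin n) (B : AIdx m n)
    (c : Fin m) (k : Fin n) (e : JetCoord m n) :
    anholonomy N f r B (pI c k) e = der N (pI c k) (vertCoeff N B f r) e := by
  simp [anholonomy, vertCoeff, der]

/-- The right side is the vertical component of `T(∂/∂p_k^c, δ/δt^b)`; `Gam_pp` expands the vertical
coefficient into the `A` and `χ` terms. The next two lemmas treat the other vertical torsions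
likewise. -/
theorem torPt_eq (hU : IsOpen U) (hD : IsHNormal N D h) {e : JetCoord m n}
    (he : e ∈ jetDomain U V) (f : Fin m) (r : Fin n) (b c : Fin m) (k : Fin n) :
    torPt N D h f r b c k e
      = anholonomy N f r (tI b) (pI c k) e - Gam N D (pI f r) (pI c k) (tI b) e := by
  have hA : Gam N D (tI f) (tI c) (tI b) e = christoffel h f c b e.1 := hD.At_eq f c b e he
  rw [anholonomy_pI, hD.Gam_pp hU _ _ _ _ _ he, hA, torPt]
  simp only [vertCoeff, Ax, eq_comm (a := k)]
  ring

theorem torPx_eq (hU : IsOpen U) (hD : IsHNormal N D h) {e : JetCoord m n}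
    (he : e ∈ jetDomain U V) (f : Fin m) (r j : Fin n) (c : Fin m) (k : Fin n) :
    torPx N D f r j c k e
      = anholonomy N f r (xI j) (pI c k) e - Gam N D (pI f r) (pI c k) (xI j) e := by
  rw [anholonomy_pI, hD.Gam_pp hU _ _ _ _ _ he, hD.Gam_tt_inr he, torPx]
  simp only [vertCoeff, Hx, ite_self]
  ring

theorem torS_eq (hU : IsOpen U) (hD : IsHNormal N D h) {e : JetCoord m n}
    (he : e ∈ jetDomain U V) (f : Fin m) (r : Fin n) (b : Fin m) (j : Fin n) (c : Fin m)
    (k : Fin n) :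
    torS N D f r b j c k e
      = Gam N D (pI f r) (pI b j) (pI c k) e - Gam N D (pI f r) (pI c k) (pI b j) e := by
  rw [hD.Gam_pp hU _ _ _ _ _ he, hD.Gam_pp hU _ _ _ _ _ he, hD.Gam_tt_inr he,
    hD.Gam_tt_inr he, torS]
  simp only [Cx, ite_self]
  ring

/-- The vertical coefficient occurs twice in `curPt`, inside the covariant derivative of `C` and
inside the torsion `P`. The two occurrences cancel and leave the bracket term of the curvature. -/
theorem curvature_xx_tp (hU : IsOpen U) (hD : IsHNormal N D h) {e : JetCoord m n}
    (he : e ∈ jetDomain U V) (i l : Fin n) (b c : Fin m) (k : Fin n) :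
    curvature N D (xI l) (xI i) (tI b) (pI c k) e = curPt N D h l i b c k e := by
  rw [hD.nlinear.curvature_xx he, curPt, covCt]
  simp only [hD.torPt_eq hU he, mul_sub, Finset.sum_sub_distrib, Ap, mul_neg,
    Finset.sum_neg_distrib, Ax, Cx]
  simp only [mul_comm (Gam N D (xI l) (xI _) (pI c k) e)]
  ring

theorem curvature_xx_xp (hU : IsOpen U) (hD : IsHNormal N D h) {e : JetCoord m n}
    (he : e ∈ jetDomain U V) (i l j : Fin n) (c : Fin m) (k : Fin n) :
    curvature N D (xI l) (xI i) (xI j) (pI c k) e = curPx N D l i j c k e := by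
  rw [hD.nlinear.curvature_xx he, curPx, covCx]
  simp only [hD.torPx_eq hU he, mul_sub, Finset.sum_sub_distrib, Hp, mul_neg,
    Finset.sum_neg_distrib, Hx, Cx]
  simp only [mul_comm (Gam N D (xI l) (xI _) (pI c k) e)]
  ring

theorem curvature_xx_pp (hD : IsHNormal N D h) {e : JetCoord m n}
    (he : e ∈ jetDomain U V) (i l : Fin n) (b : Fin m) (j : Fin n) (c : Fin m) (k : Fin n) :
    curvature N D (xI l) (xI i) (pI b j) (pI c k) e = curS N D l i b j c k e := by
  rw [hD.nlinear.curvature_xx he, curS]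
  simp only [anholonomy_pI, vertCoeff, der, fderiv_fun_const, Pi.zero_apply,
    zero_apply, mul_zero, Finset.sum_const_zero, add_zero]
  rfl

end IsHNormal

/-! ### Torsion terms for the six pairs of directions -/

/-- The torsion term of the Ricci identity. -/
noncomputable def torsionTerm (N : NonlinearConnection U V) (D : JetConnection m n)
    (X : JetField m n) (A B C : AIdx m n) (e : JetCoord m n) : ℝ :=
  ∑ F, cov1 N D X A F e * (Gam N D F B C e - Gam N D F C B e)
    + ∑ f, ∑ r, cov1 N D X A (pI f r) e * anholonomy N f r B C e

section Torsion

variable (X : JetField m n) (A : AIdx m n) {e : JetCoord m n}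

theorem IsHNormal.torsionTerm_tt (hU : IsOpen U) (hD : IsHNormal N D h)
    (he : e ∈ jetDomain U V) (b c : Fin m) :
    torsionTerm N D X A (tI b) (tI c) e
      = ∑ f, ∑ r, cov1 N D X A (pI f r) e * torRtt N f r b c e := by
  have hA : ∀ d b c, Gam N D (tI d) (tI b) (tI c) e = christoffel h d b c e.1 :=
    fun d b c => hD.At_eq d b c e he
  rw [torsionTerm, sum_adapted]
  simp only [hA, christoffel_symm hU h he.1 _ b c, hD.nlinear.Gam_xt he, hD.nlinear.Gam_pt he,
    sub_self, mul_zero, Finset.sum_const_zero, zero_add]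
  rfl

theorem IsHNormal.torsionTerm_tx (hD : IsHNormal N D h)
    (he : e ∈ jetDomain U V) (b : Fin m) (k : Fin n) :
    torsionTerm N D X A (tI b) (xI k) e
      = ∑ r, cov1 N D X A (xI r) e * torT N D r b k e
        + ∑ f, ∑ r, cov1 N D X A (pI f r) e * torRtx N f r b k e := by
  rw [torsionTerm, sum_adapted]
  simp only [hD.Gam_tt_inr he, hD.nlinear.Gam_tx he, hD.nlinear.Gam_xt he,
    hD.nlinear.Gam_pt he, hD.nlinear.Gam_px he, sub_self, zero_sub, mul_zero,
    Finset.sum_const_zero, zero_add, add_zero]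
  rfl

theorem IsCartan.torsionTerm_xx (hD : IsCartan N D h)
    (he : e ∈ jetDomain U V) (j k : Fin n) :
    torsionTerm N D X A (xI j) (xI k) e
      = ∑ f, ∑ r, cov1 N D X A (pI f r) e * torRxx N f r j k e := by
  have hH : ∀ i, Gam N D (xI i) (xI j) (xI k) e = Gam N D (xI i) (xI k) (xI j) e :=
    fun i => hD.Hx_symm i j k e he
  rw [torsionTerm, sum_adapted]
  simp only [hH, hD.nlinear.Gam_tx he, hD.nlinear.Gam_px he,
    sub_self, mul_zero, Finset.sum_const_zero, zero_add]
  rfl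

theorem IsHNormal.torsionTerm_tp (hU : IsOpen U) (hD : IsHNormal N D h)
    (he : e ∈ jetDomain U V) (b c : Fin m) (k : Fin n) :
    torsionTerm N D X A (tI b) (pI c k) e
      = ∑ f, ∑ r, cov1 N D X A (pI f r) e * torPt N D h f r b c k e := by
  rw [torsionTerm, sum_adapted]
  simp only [hD.Gam_tt_inr he, hD.nlinear.Gam_tp he, hD.nlinear.Gam_xt he,
    hD.nlinear.Gam_xp he, hD.nlinear.Gam_pt he, sub_self, zero_sub, mul_zero,
    Finset.sum_const_zero, zero_add, hD.torPt_eq hU he]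
  simp only [← Finset.sum_add_distrib]
  refine Finset.sum_congr rfl fun f _ => Finset.sum_congr rfl fun r _ => ?_
  ring

theorem IsHNormal.torsionTerm_xp (hU : IsOpen U) (hD : IsHNormal N D h)
    (he : e ∈ jetDomain U V) (j : Fin n) (c : Fin m) (k : Fin n) :
    torsionTerm N D X A (xI j) (pI c k) e
      = ∑ r, cov1 N D X A (xI r) e * Cx N D r j c k e
        + ∑ f, ∑ r, cov1 N D X A (pI f r) e * torPx N D f r j c k e := by
  rw [torsionTerm, sum_adapted]
  simp only [hD.nlinear.Gam_tp he, hD.nlinear.Gam_tx he, hD.nlinear.Gam_xp he,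
    hD.nlinear.Gam_px he, sub_self, zero_sub, sub_zero, mul_zero,
    Finset.sum_const_zero, zero_add, hD.torPx_eq hU he]
  rw [add_assoc]
  refine congrArg₂ (· + ·) rfl ?_
  simp only [← Finset.sum_add_distrib]
  refine Finset.sum_congr rfl fun f _ => Finset.sum_congr rfl fun r _ => ?_
  ring

theorem IsHNormal.torsionTerm_pp (hU : IsOpen U) (hD : IsHNormal N D h)
    (he : e ∈ jetDomain U V) (b : Fin m) (j : Fin n) (c : Fin m) (k : Fin n) :
    torsionTerm N D X A (pI b j) (pI c k) e
      = ∑ f, ∑ r, cov1 N D X A (pI f r) e * torS N D f r b j c k e := by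
  rw [torsionTerm, sum_adapted]
  simp only [hD.nlinear.Gam_tp he, hD.nlinear.Gam_xp he, sub_self, mul_zero,
    Finset.sum_const_zero, zero_add, hD.torS_eq hU he, IsHNormal.anholonomy_pI, vertCoeff, der,
    fderiv_fun_const, Pi.zero_apply, zero_apply, add_zero]

end Torsion

/-! ### Ricci identities on the three distributions -/

namespace IsHNormal

variable {X : JetField m n} {e : JetCoord m n}

theorem ricci_t (hU : IsOpen U) (hV : IsOpen V) (hD : IsHNormal N D h)
    (hX : IsSmoothField (jetDomain U V) X) (he : e ∈ jetDomain U V) (a : Fin m)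
    (B C : AIdx m n) :
    cov2 N D X (tI a) B C e - cov2 N D X (tI a) C B e
      = ∑ f, comp N X (tI f) e * curvature N D (tI a) (tI f) B C e
        - torsionTerm N D X (tI a) B C e := by
  rw [ricci_identity hU hV hD.nlinear hX _ B C he, torsionTerm, sum_adapted]
  simp only [hD.nlinear.curvature_tx hU hV he, hD.nlinear.curvature_tp hU hV he, mul_zero,
    Finset.sum_const_zero, add_zero]
  ring

theorem ricci_x (hU : IsOpen U) (hV : IsOpen V) (hD : IsHNormal N D h)
    (hX : IsSmoothField (jetDomain U V) X) (he : e ∈ jetDomain U V) (i : Fin n)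
    (B C : AIdx m n) :
    cov2 N D X (xI i) B C e - cov2 N D X (xI i) C B e
      = ∑ r, comp N X (xI r) e * curvature N D (xI i) (xI r) B C e
        - torsionTerm N D X (xI i) B C e := by
  rw [ricci_identity hU hV hD.nlinear hX _ B C he, torsionTerm, sum_adapted]
  simp only [hD.nlinear.curvature_xt hU hV he, hD.nlinear.curvature_xp hU hV he, mul_zero,
    Finset.sum_const_zero, add_zero, zero_add]
  ring

/-- Splitting the vertical curvature contracts the double index of `X` in two ways: the spatial part
keeps `a` and sums over `r`, the temporal part keeps `i` and sums over `f`. -/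
theorem ricci_p (hU : IsOpen U) (hV : IsOpen V) (hD : IsHNormal N D h)
    (hX : IsSmoothField (jetDomain U V) X) (he : e ∈ jetDomain U V) (a : Fin m) (i : Fin n)
    (B C : AIdx m n) :
    cov2 N D X (pI a i) B C e - cov2 N D X (pI a i) C B e
      = -∑ r, comp N X (pI a r) e * curvature N D (xI r) (xI i) B C e
        + ∑ f, comp N X (pI f i) e * curvature N D (tI a) (tI f) B C e
        - torsionTerm N D X (pI a i) B C e := by
  rw [ricci_identity hU hV hD.nlinear hX _ B C he, torsionTerm, sum_adapted]
  simp only [hD.nlinear.curvature_pt hU hV he, hD.nlinear.curvature_px hU hV he, mul_zero,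
    Finset.sum_const_zero, zero_add, hD.curvature_pp hU hV _ _ _ _ B C he, mul_sub, mul_ite,
    Finset.sum_sub_distrib, Finset.sum_ite_eq, Finset.mem_univ, if_true]
  have hs : ∑ f, ∑ r, (if a = f then
      comp N X (pI f r) e * curvature N D (xI r) (xI i) B C e else 0)
      = ∑ r, comp N X (pI a r) e * curvature N D (xI r) (xI i) B C e := by
    rw [Finset.sum_eq_single a] <;> simp +contextual [eq_comm]
  rw [hs]
  ring

end IsHNormal

end DualJet

theorem mainTheorem4 {m n : ℕ} {U : Set (Fin m → ℝ)} {V : Set (Fin n → ℝ)}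
    (hU : IsOpen U) (hV : IsOpen V)
    (h : TemporalMetric U) (N : NonlinearConnection U V)
    (D : JetConnection m n) (hD : IsCartan N D h)
    (X : JetField m n) (hX : IsSmoothField (jetDomain U V) X)
    (e : JetCoord m n) (he : e ∈ jetDomain U V) :
    -- the h_T-set
    ((∀ a b c : Fin m,
        cov2 N D X (tI a) (tI b) (tI c) e - cov2 N D X (tI a) (tI c) (tI b) e
          = ∑ f, comp N X (tI f) e * chiCurv h a f b c e.1
            - ∑ f, ∑ r, cov1 N D X (tI a) (pI f r) e * torRtt N f r b c e) ∧
      (∀ (a b : Fin m) (k : Fin n),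
        cov2 N D X (tI a) (tI b) (xI k) e - cov2 N D X (tI a) (xI k) (tI b) e
          = -∑ r, cov1 N D X (tI a) (xI r) e * torT N D r b k e
            - ∑ f, ∑ r, cov1 N D X (tI a) (pI f r) e * torRtx N f r b k e) ∧
      (∀ (a : Fin m) (j k : Fin n),
        cov2 N D X (tI a) (xI j) (xI k) e - cov2 N D X (tI a) (xI k) (xI j) e
          = -∑ f, ∑ r, cov1 N D X (tI a) (pI f r) e * torRxx N f r j k e) ∧
      (∀ (a b c : Fin m) (k : Fin n),
        cov2 N D X (tI a) (tI b) (pI c k) e - cov2 N D X (tI a) (pI c k) (tI b) e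
          = -∑ f, ∑ r, cov1 N D X (tI a) (pI f r) e * torPt N D h f r b c k e) ∧
      (∀ (a : Fin m) (j : Fin n) (c : Fin m) (k : Fin n),
        cov2 N D X (tI a) (xI j) (pI c k) e - cov2 N D X (tI a) (pI c k) (xI j) e
          = -∑ r, cov1 N D X (tI a) (xI r) e * Cx N D r j c k e
            - ∑ f, ∑ r, cov1 N D X (tI a) (pI f r) e * torPx N D f r j c k e) ∧
      (∀ (a b : Fin m) (j : Fin n) (c : Fin m) (k : Fin n),
        cov2 N D X (tI a) (pI b j) (pI c k) e - cov2 N D X (tI a) (pI c k) (pI b j) e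
          = -∑ f, ∑ r, cov1 N D X (tI a) (pI f r) e * torS N D f r b j c k e)) ∧
    -- the h_M-set
    ((∀ (i : Fin n) (b c : Fin m),
        cov2 N D X (xI i) (tI b) (tI c) e - cov2 N D X (xI i) (tI c) (tI b) e
          = ∑ r, comp N X (xI r) e * curRtt N D i r b c e
            - ∑ f, ∑ r, cov1 N D X (xI i) (pI f r) e * torRtt N f r b c e) ∧
      (∀ (i : Fin n) (b : Fin m) (k : Fin n),
        cov2 N D X (xI i) (tI b) (xI k) e - cov2 N D X (xI i) (xI k) (tI b) e
          = ∑ r, comp N X (xI r) e * curRtx N D i r b k e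
            - ∑ r, cov1 N D X (xI i) (xI r) e * torT N D r b k e
            - ∑ f, ∑ r, cov1 N D X (xI i) (pI f r) e * torRtx N f r b k e) ∧
      (∀ i j k : Fin n,
        cov2 N D X (xI i) (xI j) (xI k) e - cov2 N D X (xI i) (xI k) (xI j) e
          = ∑ r, comp N X (xI r) e * curRxx N D i r j k e
            - ∑ f, ∑ r, cov1 N D X (xI i) (pI f r) e * torRxx N f r j k e) ∧
      (∀ (i : Fin n) (b c : Fin m) (k : Fin n),
        cov2 N D X (xI i) (tI b) (pI c k) e - cov2 N D X (xI i) (pI c k) (tI b) e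
          = ∑ r, comp N X (xI r) e * curPt N D h i r b c k e
            - ∑ f, ∑ r, cov1 N D X (xI i) (pI f r) e * torPt N D h f r b c k e) ∧
      (∀ (i j : Fin n) (c : Fin m) (k : Fin n),
        cov2 N D X (xI i) (xI j) (pI c k) e - cov2 N D X (xI i) (pI c k) (xI j) e
          = ∑ r, comp N X (xI r) e * curPx N D i r j c k e
            - ∑ r, cov1 N D X (xI i) (xI r) e * Cx N D r j c k e
            - ∑ f, ∑ r, cov1 N D X (xI i) (pI f r) e * torPx N D f r j c k e) ∧
      (∀ (i : Fin n) (b : Fin m) (j : Fin n) (c : Fin m) (k : Fin n),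
        cov2 N D X (xI i) (pI b j) (pI c k) e - cov2 N D X (xI i) (pI c k) (pI b j) e
          = ∑ r, comp N X (xI r) e * curS N D i r b j c k e
            - ∑ f, ∑ r, cov1 N D X (xI i) (pI f r) e * torS N D f r b j c k e)) ∧
    -- the v-set
    ((∀ (a : Fin m) (i : Fin n) (b c : Fin m),
        cov2 N D X (pI a i) (tI b) (tI c) e - cov2 N D X (pI a i) (tI c) (tI b) e
          = -∑ r, comp N X (pI a r) e * curRtt N D r i b c e
            + ∑ f, comp N X (pI f i) e * chiCurv h a f b c e.1
            - ∑ f, ∑ r, cov1 N D X (pI a i) (pI f r) e * torRtt N f r b c e) ∧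
      (∀ (a : Fin m) (i : Fin n) (b : Fin m) (k : Fin n),
        cov2 N D X (pI a i) (tI b) (xI k) e - cov2 N D X (pI a i) (xI k) (tI b) e
          = -∑ r, comp N X (pI a r) e * curRtx N D r i b k e
            - ∑ r, cov1 N D X (pI a i) (xI r) e * torT N D r b k e
            - ∑ f, ∑ r, cov1 N D X (pI a i) (pI f r) e * torRtx N f r b k e) ∧
      (∀ (a : Fin m) (i j k : Fin n),
        cov2 N D X (pI a i) (xI j) (xI k) e - cov2 N D X (pI a i) (xI k) (xI j) e
          = -∑ r, comp N X (pI a r) e * curRxx N D r i j k e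
            - ∑ f, ∑ r, cov1 N D X (pI a i) (pI f r) e * torRxx N f r j k e) ∧
      (∀ (a : Fin m) (i : Fin n) (b c : Fin m) (k : Fin n),
        cov2 N D X (pI a i) (tI b) (pI c k) e - cov2 N D X (pI a i) (pI c k) (tI b) e
          = -∑ r, comp N X (pI a r) e * curPt N D h r i b c k e
            - ∑ f, ∑ r, cov1 N D X (pI a i) (pI f r) e * torPt N D h f r b c k e) ∧
      (∀ (a : Fin m) (i j : Fin n) (c : Fin m) (k : Fin n),
        cov2 N D X (pI a i) (xI j) (pI c k) e - cov2 N D X (pI a i) (pI c k) (xI j) e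
          = -∑ r, comp N X (pI a r) e * curPx N D r i j c k e
            - ∑ r, cov1 N D X (pI a i) (xI r) e * Cx N D r j c k e
            - ∑ f, ∑ r, cov1 N D X (pI a i) (pI f r) e * torPx N D f r j c k e) ∧
      (∀ (a : Fin m) (i : Fin n) (b : Fin m) (j : Fin n) (c : Fin m) (k : Fin n),
        cov2 N D X (pI a i) (pI b j) (pI c k) e - cov2 N D X (pI a i) (pI c k) (pI b j) e
          = -∑ r, comp N X (pI a r) e * curS N D r i b j c k e
            - ∑ f, ∑ r, cov1 N D X (pI a i) (pI f r) e * torS N D f r b j c k e)) := by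
  have hH := hD.toIsHNormal
  refine ⟨⟨?_, ?_, ?_, ?_, ?_, ?_⟩, ⟨?_, ?_, ?_, ?_, ?_, ?_⟩, ⟨?_, ?_, ?_, ?_, ?_, ?_⟩⟩ <;>
    intros <;>
    -- The distribution of the differentiated component selects the Ricci identity, then the pair of
    -- directions selects the torsion formula.
    first
    | rw [hH.ricci_t hU hV hX he]
    | rw [hH.ricci_x hU hV hX he]
    | rw [hH.ricci_p hU hV hX he]
  all_goals
    first
    | rw [hH.torsionTerm_tt _ _ hU he]
    | rw [hH.torsionTerm_tx _ _ he]
    | rw [hD.torsionTerm_xx _ _ he]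
    | rw [hH.torsionTerm_tp _ _ hU he]
    | rw [hH.torsionTerm_xp _ _ hU he]
    | rw [hH.torsionTerm_pp _ _ hU he]
  all_goals
    -- In every pair other than two temporal directions the second direction is spatial or vertical,
    -- so `curvature_tt_inr` removes the temporal curvature.
    simp only [hH.curvature_tt_tt hU hV he, hH.curvature_tt_inr hU hV he,
      hH.curvature_xx_tt he, hH.curvature_xx_tx he, hH.curvature_xx_xx he,
      hH.curvature_xx_tp hU he, hH.curvature_xx_xp hU he, hH.curvature_xx_pp he,
      mul_zero, Finset.sum_const_zero] <;> ring
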